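/- Let $\mathscr T=((T^+,\Delta^+),(T,\Delta))$ be a concrete regularity structure. That is: $T^+=\bigoplus_{\alpha\in A^+}T^+_\alpha$ and $T=\bigoplus_{\beta\in A}T_\beta$ are real vector spaces graded by sets $A^+\subset[0,\infty)$ and $A\subset\mathbb R$ without accumulation points in $\mathbb R$, with $0\in A^+$, $A^++A^+\subset A^+$, $A$ bounded below, and finite dimensional homogeneous components; $T^+$ is a Hopf algebra with unit $\mathbf 1$, coproduct $\Delta^+$, $T^+_0=\langle\mathbf 1\rangle$, $T^+_\alpha T^+_\beta\subset T^+_{\alpha+\beta}$, and $$\Delta^+\tau\in\tau\otimes\mathbf 1+\mathbf 1\otimes\tau+\sum_{0<\beta<\alpha}T^+_\beta\otimes T^+_{\alpha-\beta}\qquad(\tau\in T^+_\alpha,\ \alpha>0);$$ the linear map $\Delta:T\to T\otimes T^+$ satisfies $\Delta\tau\in\tau\otimes\mathbf 1+\sum_{\beta<\alpha}T_\beta\otimes T^+_{\alpha-\beta}$ for $\tau\in T_\alpha$, and $(\Delta\otimes\mathrm{Id})\Delta=(\mathrm{Id}\otimes\Delta^+)\Delta$. Let $\mathcal B^+\ni\mathbf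 1$ and $\mathcal B$ be bases of $T^+$ and $T$ made of homogeneous elements, and let $|\tau|$ be the degree of a basis element $\tau$. For $\tau\in\mathcal B$ write $\Delta\tau=\sum_{\sigma\in\mathcal B}\sigma\otimes(\tau/\sigma)$ with $\tau/\sigma\in T^+$, and write $\sigma<\tau$ if $\tau/\sigma\neq0$ and $\sigma\neq\tau$. For $\tau\in\mathcal B^+$ write $\Delta^+\tau=\sum_{\sigma\in\mathcal B^+}\sigma\otimes(\tau/^+\sigma)$, and define $\sigma<^+\tau$ in the same way. Let $\mathsf g:\mathbb R^d\to G^+$, $x\mapsto\mathsf g_x$, take values in the group of unital real characters of $T^+$ (with convolution as product). Set $\mathsf g_{yx}:=\mathsf g_y*\mathsf g_x^{-1}$, and assume that for every $\tau\in\mathcal B^+$ $$\sup_{x}|\mathsf g_x(\tau)|+\sup_{x\ne y}\frac{|\mathsf g_{yx}(\tau)|}{|y-x|^{|\tau|}}<\infty .$$ This holds for instance if $(\mathsf g,\mathsf\Pi)$ is a model on $\mathscr T$. For $\tau\in T^+$ let $\mathsf g(\tau)$ be the bounded function $x\mapsto\mathsf g_x(\tau)$, viewed as a tempered distribution. Let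 $\Delta_i$ $(i\ge-1)$ be the Littlewood--Paley blocks of a dyadic partition of unity $(\rho_i)_{i\ge-1}$ with smooth radial $\rho_i:\mathbb R^d\to[0,1]$, $\operatorname{supp}\rho_{-1}\subset\{|x|<\frac43\}$, $\operatorname{supp}\rho_0\subset\{\frac34<|x|<\frac83\}$, $\rho_i=\rho_0(2^{-i}\cdot)$ for $i\ge0$, and let $\mathsf P_fh:=\sum_{j\ge1}\big(\sum_{-1\le i\le j-2}\Delta_if\big)\Delta_jh$ be the paraproduct, as a series in $\mathcal S'(\mathbb R^d)$. Define $\langle\!\langle\tau\rangle\!\rangle^{\mathsf g}$ for $\tau\in\mathcal B^+$ by recursion on $|\tau|$ through $$\mathsf g(\tau)=\sum_{\nu\in\mathcal B^+,\ \mathbf 1<^+\nu<^+\tau}\mathsf P_{\mathsf g(\tau/^+\nu)}\langle\!\langle\nu\rangle\!\rangle^{\mathsf g}+\langle\!\langle\tau\rangle\!\rangle^{\mathsf g},$$ and extend $\langle\!\langle\cdot\rangle\!\rangle^{\mathsf g}$ linearly to $T^+$. Then all the paraproduct series in this recursion converge in $\mathcal S'(\mathbb R^d)$, and for all $\sigma,\tau\in\mathcal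 B$ with $\sigma<\tau$ one has $$\mathsf g(\tau/\sigma)=\sum_{\eta\in\mathcal B,\ \sigma<\eta<\tau}\mathsf P_{\mathsf g(\tau/\eta)}\langle\!\langle\eta/\sigma\rangle\!\rangle^{\mathsf g}+\langle\!\langle\tau/\sigma\rangle\!\rangle^{\mathsf g},$$ where again all the paraproduct series converge in $\mathcal S'(\mathbb R^d)$. -/

import Mathlib

open scoped TensorProduct SchwartzMap FourierTransform ContDiff
open MeasureTheory

noncomputable section

/-! ### Concrete regularity structures -/

/-- The subspace `V ⊗ W` of `M ⊗ N`, for subspaces `V` of `M` and `W` of `N`. -/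
def tensorSubmodule {M N : Type*} [AddCommGroup M] [Module ℝ M] [AddCommGroup N] [Module ℝ N]
    (V : Submodule ℝ M) (W : Submodule ℝ N) : Submodule ℝ (M ⊗[ℝ] N) :=
  LinearMap.range (TensorProduct.map V.subtype W.subtype)

/-- A concrete regularity structure `((T⁺, Δ⁺), (T, Δ))`. The algebra `T⁺`, its coproduct `Δ⁺`
(`Coalgebra.comul`), counit and antipode are given by `[Ring Tp] [HopfAlgebra ℝ Tp]`. Both gradings
are written as families of subspaces indexed by `ℝ` which vanish outside the index sets. -/
structure ConcreteRegularityStructure (Tp T : Type*) [Ring Tp] [HopfAlgebra ℝ Tp]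
    [AddCommGroup T] [Module ℝ T] where
  /-- the index set `A⁺` of `T⁺` -/
  Ap : Set ℝ
  /-- the index set `A` of `T` -/
  A : Set ℝ
  /-- the homogeneous subspaces `T⁺_α` -/
  gradeP : ℝ → Submodule ℝ Tp
  /-- the homogeneous subspaces `T_β` -/
  grade : ℝ → Submodule ℝ T
  /-- the splitting map `Δ : T → T ⊗ T⁺` -/
  split : T →ₗ[ℝ] T ⊗[ℝ] Tp
  zero_mem_Ap : (0 : ℝ) ∈ Ap
  Ap_nonneg : ∀ α ∈ Ap, 0 ≤ α
  Ap_add : ∀ α ∈ Ap, ∀ β ∈ Ap, α + β ∈ Ap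
  A_bddBelow : BddBelow A
  Ap_discrete : ∀ x : ℝ, ¬ AccPt x (Filter.principal Ap)
  A_discrete : ∀ x : ℝ, ¬ AccPt x (Filter.principal A)
  gradeP_internal : DirectSum.IsInternal gradeP
  grade_internal : DirectSum.IsInternal grade
  gradeP_eq_bot : ∀ α, α ∉ Ap → gradeP α = ⊥
  grade_eq_bot : ∀ β, β ∉ A → grade β = ⊥
  gradeP_finite : ∀ α, FiniteDimensional ℝ (gradeP α)
  grade_finite : ∀ β, FiniteDimensional ℝ (grade β)
  gradeP_zero : gradeP 0 = Submodule.span ℝ {(1 : Tp)}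
  mul_mem_gradeP : ∀ α β : ℝ, ∀ a ∈ gradeP α, ∀ b ∈ gradeP β, a * b ∈ gradeP (α + β)
  comul_mem : ∀ α : ℝ, 0 < α → ∀ t ∈ gradeP α,
    Coalgebra.comul (R := ℝ) t - t ⊗ₜ[ℝ] (1 : Tp) - (1 : Tp) ⊗ₜ[ℝ] t ∈
      ⨆ β ∈ Set.Ioo 0 α, tensorSubmodule (gradeP β) (gradeP (α - β))
  split_mem : ∀ α : ℝ, ∀ t ∈ grade α,
    split t - t ⊗ₜ[ℝ] (1 : Tp) ∈
      ⨆ β ∈ Set.Iio α, tensorSubmodule (grade β) (gradeP (α - β))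
  /-- the right comodule property `(Δ ⊗ Id) Δ = (Id ⊗ Δ⁺) Δ` -/
  split_comodule :
    (TensorProduct.assoc ℝ T Tp Tp).toLinearMap ∘ₗ split.rTensor Tp ∘ₗ split =
      (Coalgebra.comul (R := ℝ) (A := Tp)).lTensor T ∘ₗ split

/-- Homogeneous bases `𝓑⁺` of `T⁺` and `𝓑` of `T`, indexed by `ιp` and `ι`. The elements of
homogeneity `α` form a basis of the homogeneous subspace of degree `α`, and `𝓑⁺` contains the
unit, so that `𝓑⁺_0 = {1}`. -/
structure HomogeneousBases {Tp T : Type*} [Ring Tp] [HopfAlgebra ℝ Tp]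
    [AddCommGroup T] [Module ℝ T] (S : ConcreteRegularityStructure Tp T) (ιp ι : Type*) where
  basisP : Module.Basis ιp ℝ Tp
  basis : Module.Basis ι ℝ T
  /-- homogeneity of the elements of `𝓑⁺` -/
  degP : ιp → ℝ
  /-- homogeneity of the elements of `𝓑` -/
  deg : ι → ℝ
  basisP_mem : ∀ i, basisP i ∈ S.gradeP (degP i)
  basis_mem : ∀ i, basis i ∈ S.grade (deg i)
  /-- the label of the unit -/
  one : ιp
  basisP_one : basisP one = 1

namespace HomogeneousBases

open Classical in
/-- `τ ↦ (σ ↦ τ /⁺ σ)` on `𝓑⁺`, determined by `Δ⁺ τ = ∑ σ ⊗ (τ /⁺ σ)`. -/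
def quotP {Tp T : Type*} [Ring Tp] [HopfAlgebra ℝ Tp] [AddCommGroup T] [Module ℝ T]
    {S : ConcreteRegularityStructure Tp T} {ιp ι : Type*} (B : HomogeneousBases S ιp ι)
    (τ : ιp) : ιp →₀ Tp :=
  TensorProduct.equivFinsuppOfBasisLeft B.basisP (Coalgebra.comul (R := ℝ) (B.basisP τ))

open Classical in
/-- `τ ↦ (σ ↦ τ / σ)` on `𝓑`, determined by `Δ τ = ∑ σ ⊗ (τ / σ)`. -/
def quot {Tp T : Type*} [Ring Tp] [HopfAlgebra ℝ Tp] [AddCommGroup T] [Module ℝ T]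
    {S : ConcreteRegularityStructure Tp T} {ιp ι : Type*} (B : HomogeneousBases S ιp ι)
    (τ : ι) : ι →₀ Tp :=
  TensorProduct.equivFinsuppOfBasisLeft B.basis (S.split (B.basis τ))

/-- `σ <⁺ τ` in `𝓑⁺`: `σ` is different from `τ` and appears on the left in `Δ⁺ τ`. -/
def ltP {Tp T : Type*} [Ring Tp] [HopfAlgebra ℝ Tp] [AddCommGroup T] [Module ℝ T]
    {S : ConcreteRegularityStructure Tp T} {ιp ι : Type*} (B : HomogeneousBases S ιp ι)
    (σ τ : ιp) : Prop :=
  B.quotP τ σ ≠ 0 ∧ σ ≠ τ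

/-- `σ < τ` in `𝓑`: `σ` is different from `τ` and appears on the left in `Δ τ`. -/
def lt {Tp T : Type*} [Ring Tp] [HopfAlgebra ℝ Tp] [AddCommGroup T] [Module ℝ T]
    {S : ConcreteRegularityStructure Tp T} {ιp ι : Type*} (B : HomogeneousBases S ιp ι)
    (σ τ : ι) : Prop :=
  B.quot τ σ ≠ 0 ∧ σ ≠ τ

open Classical in
/-- The finite set of all `ν ∈ 𝓑⁺` with `σ <⁺ ν <⁺ τ`. -/
def betweenP {Tp T : Type*} [Ring Tp] [HopfAlgebra ℝ Tp] [AddCommGroup T] [Module ℝ T]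
    {S : ConcreteRegularityStructure Tp T} {ιp ι : Type*} (B : HomogeneousBases S ιp ι)
    (σ τ : ιp) : Finset ιp :=
  (B.quotP τ).support.filter (fun ν => B.ltP σ ν ∧ B.ltP ν τ)

open Classical in
/-- The finite set of all `η ∈ 𝓑` with `σ < η < τ`. -/
def between {Tp T : Type*} [Ring Tp] [HopfAlgebra ℝ Tp] [AddCommGroup T] [Module ℝ T]
    {S : ConcreteRegularityStructure Tp T} {ιp ι : Type*} (B : HomogeneousBases S ιp ι)
    (σ τ : ι) : Finset ι :=
  (B.quot τ).support.filter (fun η => B.lt σ η ∧ B.lt η τ)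

theorem mem_betweenP {Tp T : Type*} [Ring Tp] [HopfAlgebra ℝ Tp] [AddCommGroup T] [Module ℝ T]
    {S : ConcreteRegularityStructure Tp T} {ιp ι : Type*} (B : HomogeneousBases S ιp ι)
    (σ τ ν : ιp) : ν ∈ B.betweenP σ τ ↔ B.ltP σ ν ∧ B.ltP ν τ := by
  classical
  simp only [betweenP, Finset.mem_filter, Finsupp.mem_support_iff]
  exact ⟨fun h => h.2, fun h => ⟨h.2.1, h⟩⟩

theorem mem_between {Tp T : Type*} [Ring Tp] [HopfAlgebra ℝ Tp] [AddCommGroup T] [Module ℝ T]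
    {S : ConcreteRegularityStructure Tp T} {ιp ι : Type*} (B : HomogeneousBases S ιp ι)
    (σ τ η : ι) : η ∈ B.between σ τ ↔ B.lt σ η ∧ B.lt η τ := by
  classical
  simp only [between, Finset.mem_filter, Finsupp.mem_support_iff]
  exact ⟨fun h => h.2, fun h => ⟨h.2.1, h⟩⟩

/-- The coordinates of a homogeneous element vanish along basis elements of other degrees. -/
theorem coord_eq_zero {Tp T : Type*} [Ring Tp] [HopfAlgebra ℝ Tp] [AddCommGroup T] [Module ℝ T]
    {S : ConcreteRegularityStructure Tp T} {ιp ι : Type*} (B : HomogeneousBases S ιp ι)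
    {α : ℝ} {x : Tp} (hx : x ∈ S.gradeP α) {i : ιp} (hi : B.degP i ≠ α) :
    B.basisP.repr x i = 0 := by
  classical
  set r := (B.basisP.repr x).filter (fun j => B.degP j ≠ α) with hr
  set s := (B.basisP.repr x).filter (fun j => ¬ B.degP j ≠ α) with hs
  have hsum : r + s = B.basisP.repr x := Finsupp.filter_add_filter_not _ _
  have h1 : B.basisP.repr.symm s ∈ S.gradeP α := by
    rw [Module.Basis.repr_symm_apply, Finsupp.linearCombination_apply]
    refine Submodule.sum_mem _ fun j hj => Submodule.smul_mem _ _ ?_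
    have : B.degP j = α := by
      by_contra h
      exact (Finsupp.mem_support_iff.1 hj) (Finsupp.filter_apply_neg _ _ (by simpa using h))
    exact this ▸ B.basisP_mem j
  have h2 : B.basisP.repr.symm r ∈ ⨆ β, ⨆ (_ : β ≠ α), S.gradeP β := by
    rw [Module.Basis.repr_symm_apply, Finsupp.linearCombination_apply]
    refine Submodule.sum_mem _ fun j hj => Submodule.smul_mem _ _ ?_
    have : B.degP j ≠ α := by
      by_contra h
      exact (Finsupp.mem_support_iff.1 hj) (Finsupp.filter_apply_neg _ _ (by simpa using h))
    exact Submodule.mem_iSup_of_mem _ (Submodule.mem_iSup_of_mem this (B.basisP_mem j))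
  have h3 : B.basisP.repr.symm r ∈ S.gradeP α := by
    have : B.basisP.repr.symm r = x - B.basisP.repr.symm s := by
      rw [eq_sub_iff_add_eq, ← map_add, hsum, LinearEquiv.symm_apply_apply]
    rw [this]
    exact Submodule.sub_mem _ hx h1
  have h4 : B.basisP.repr.symm r = 0 :=
    (Submodule.disjoint_def.1 (S.gradeP_internal.submodule_iSupIndep α)) _ h3 h2
  have h5 : r = 0 := (LinearEquiv.map_eq_zero_iff _).1 h4
  have h6 : r i = B.basisP.repr x i := Finsupp.filter_apply_pos _ _ hi
  rw [← h6, h5]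
  rfl

theorem degP_mem {Tp T : Type*} [Ring Tp] [HopfAlgebra ℝ Tp] [AddCommGroup T] [Module ℝ T]
    {S : ConcreteRegularityStructure Tp T} {ιp ι : Type*} (B : HomogeneousBases S ιp ι)
    (i : ιp) : B.degP i ∈ S.Ap := by
  by_contra h
  have := B.basisP_mem i
  rw [S.gradeP_eq_bot _ h, Submodule.mem_bot] at this
  exact B.basisP.ne_zero i this

/-- If `1 <⁺ ν <⁺ τ` then `|ν| < |τ|`. -/
theorem degP_lt {Tp T : Type*} [Ring Tp] [HopfAlgebra ℝ Tp] [AddCommGroup T] [Module ℝ T]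
    {S : ConcreteRegularityStructure Tp T} {ιp ι : Type*} (B : HomogeneousBases S ιp ι)
    {ν τ : ιp} (h : ν ∈ B.betweenP B.one τ) : B.degP ν < B.degP τ := by
  classical
  rw [mem_betweenP] at h
  obtain ⟨⟨-, h1⟩, h2, h3⟩ := h
  have hone : B.basisP.repr 1 ν = 0 := by
    rw [← B.basisP_one, Module.Basis.repr_self, Finsupp.single_eq_of_ne (Ne.symm h1)]
  rcases (S.Ap_nonneg _ (B.degP_mem τ)).eq_or_lt with h0 | h0
  · exfalso
    have hm := B.basisP_mem τ
    rw [← h0, S.gradeP_zero, Submodule.mem_span_singleton] at hm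
    obtain ⟨c, hc⟩ := hm
    apply h2
    rw [quotP, ← hc, map_smul, Bialgebra.comul_one, map_smul, Algebra.TensorProduct.one_def]
    simp [hone]
  · by_contra hlt
    apply h2
    have key : ∀ z ∈ ⨆ β ∈ Set.Ioo 0 (B.degP τ),
        tensorSubmodule (S.gradeP β) (S.gradeP (B.degP τ - β)),
        TensorProduct.equivFinsuppOfBasisLeft B.basisP z ν = 0 := by
      intro z hz
      have hle : (⨆ β ∈ Set.Ioo 0 (B.degP τ),
          tensorSubmodule (S.gradeP β) (S.gradeP (B.degP τ - β))) ≤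
          LinearMap.ker (Finsupp.lapply (R := ℝ) ν ∘ₗ
            (TensorProduct.equivFinsuppOfBasisLeft (N := Tp) B.basisP).toLinearMap) := by
        refine iSup₂_le fun β hβ => ?_
        rintro _ ⟨w, rfl⟩
        rw [LinearMap.mem_ker]
        induction w using TensorProduct.induction_on with
        | zero => simp
        | add a b ha hb => rw [map_add, map_add, ha, hb, add_zero]
        | tmul a b =>
          have : B.basisP.repr (a : Tp) ν = 0 :=
            B.coord_eq_zero a.2 (fun e => hlt (e ▸ hβ.2))
          simp [this]
      exact LinearMap.mem_ker.1 (hle hz)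
    have hk := key _ (S.comul_mem _ h0 _ (B.basisP_mem τ))
    rw [map_sub, map_sub, Finsupp.sub_apply, Finsupp.sub_apply,
      TensorProduct.equivFinsuppOfBasisLeft_apply_tmul_apply,
      TensorProduct.equivFinsuppOfBasisLeft_apply_tmul_apply, hone,
      Module.Basis.repr_self, Finsupp.single_eq_of_ne h3] at hk
    simpa [quotP] using hk

/-- The number of elements of `A⁺` below `|τ|`; it is used only to justify recursions on `|τ|`. -/
def rankP {Tp T : Type*} [Ring Tp] [HopfAlgebra ℝ Tp] [AddCommGroup T] [Module ℝ T]
    {S : ConcreteRegularityStructure Tp T} {ιp ι : Type*} (B : HomogeneousBases S ιp ι)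
    (τ : ιp) : ℕ :=
  (S.Ap ∩ Set.Iio (B.degP τ)).ncard

theorem rankP_lt {Tp T : Type*} [Ring Tp] [HopfAlgebra ℝ Tp] [AddCommGroup T] [Module ℝ T]
    {S : ConcreteRegularityStructure Tp T} {ιp ι : Type*} (B : HomogeneousBases S ιp ι)
    {ν τ : ιp} (h : ν ∈ B.betweenP B.one τ) : B.rankP ν < B.rankP τ := by
  have hlt := B.degP_lt h
  have hfin : (S.Ap ∩ Set.Iio (B.degP τ)).Finite := by
    by_contra hinf
    obtain ⟨x, -, hx⟩ := Set.Infinite.exists_accPt_of_subset_isCompact hinf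
      (isCompact_Icc (a := (0 : ℝ)) (b := B.degP τ))
      (fun y hy => ⟨S.Ap_nonneg y hy.1, le_of_lt hy.2⟩)
    exact S.Ap_discrete x (hx.mono (Filter.principal_mono.2 Set.inter_subset_left))
  refine Set.ncard_lt_ncard ⟨fun y hy => ⟨hy.1, lt_trans hy.2 hlt⟩, fun hsub => ?_⟩ hfin
  exact lt_irrefl (B.degP ν) (hsub ⟨B.degP_mem ν, hlt⟩).2

end HomogeneousBases

/-! ### The map `g` of a model -/

/-- `g_{yx} = g_y * g_x⁻¹`, for the convolution of characters, with `g_x⁻¹ = g_x ∘ antipode`. -/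
def charIncrement {X Tp : Type*} [Ring Tp] [HopfAlgebra ℝ Tp] (g : X → Tp →ₐ[ℝ] ℝ) (y x : X) :
    Tp →ₗ[ℝ] ℝ :=
  LinearMap.mul' ℝ ℝ ∘ₗ
    TensorProduct.map (g y).toLinearMap ((g x).toLinearMap ∘ₗ HopfAlgebra.antipode ℝ) ∘ₗ
      Coalgebra.comul

/-- The bounds imposed on the component `g : ℝᵈ → G⁺` of a model. The constant may depend on the
basis element, which is weaker than a bound uniform over the basis. -/
def IsModelMap {d : ℕ} {Tp T : Type*} [Ring Tp] [HopfAlgebra ℝ Tp] [AddCommGroup T] [Module ℝ T]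
    {S : ConcreteRegularityStructure Tp T} {ιp ι : Type*} (B : HomogeneousBases S ιp ι)
    (g : EuclideanSpace ℝ (Fin d) → Tp →ₐ[ℝ] ℝ) : Prop :=
  ∀ τ : ιp, ∃ C : ℝ, (∀ x, |g x (B.basisP τ)| ≤ C) ∧
    ∀ x y, |charIncrement g y x (B.basisP τ)| ≤ C * ‖y - x‖ ^ B.degP τ

/-! ### Littlewood-Paley blocks and the paraproduct -/

/-- A dyadic partition of unity of `ℝᵈ`, given by `ρ₋₁ = low` and `ρ₀ = base`. -/
structure DyadicPartition (d : ℕ) where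
  low : EuclideanSpace ℝ (Fin d) → ℝ
  base : EuclideanSpace ℝ (Fin d) → ℝ
  low_smooth : ContDiff ℝ ∞ low
  base_smooth : ContDiff ℝ ∞ base
  low_mem : ∀ ξ, low ξ ∈ Set.Icc (0 : ℝ) 1
  base_mem : ∀ ξ, base ξ ∈ Set.Icc (0 : ℝ) 1
  low_radial : ∀ ξ ζ, ‖ξ‖ = ‖ζ‖ → low ξ = low ζ
  base_radial : ∀ ξ ζ, ‖ξ‖ = ‖ζ‖ → base ξ = base ζ
  low_support : tsupport low ⊆ {ξ | ‖ξ‖ < 4 / 3}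
  base_support : tsupport base ⊆ {ξ | 3 / 4 < ‖ξ‖ ∧ ‖ξ‖ < 8 / 3}
  sum_eq_one : ∀ ξ, HasSum (fun n : ℕ => base ((2 : ℝ)⁻¹ ^ n • ξ)) (1 - low ξ)

namespace DyadicPartition

/-- The functions of the partition, with the index shifted by one: `symbol n = ρ_{n-1}`. -/
def symbol {d : ℕ} (P : DyadicPartition d) : ℕ → EuclideanSpace ℝ (Fin d) → ℝ
  | 0 => P.low
  | n + 1 => fun ξ => P.base ((2 : ℝ)⁻¹ ^ n • ξ)

theorem symbol_smooth {d : ℕ} (P : DyadicPartition d) (n : ℕ) :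
    ContDiff ℝ ∞ (fun ξ => (P.symbol n ξ : ℂ)) := by
  refine Complex.ofRealCLM.contDiff.comp ?_
  cases n with
  | zero => exact P.low_smooth
  | succ n => exact P.base_smooth.comp (contDiff_const_smul _)

theorem symbol_compact {d : ℕ} (P : DyadicPartition d) (n : ℕ) :
    HasCompactSupport (fun ξ => (P.symbol n ξ : ℂ)) := by
  have h : HasCompactSupport (P.symbol n) := by
    cases n with
    | zero =>
      refine HasCompactSupport.of_support_subset_isCompact
        (isCompact_closedBall (0 : EuclideanSpace ℝ (Fin d)) (4 / 3)) fun ξ hξ => ?_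
      have := P.low_support (subset_tsupport _ hξ)
      simpa using le_of_lt this
    | succ n =>
      have hb : HasCompactSupport P.base := by
        refine HasCompactSupport.of_support_subset_isCompact
          (isCompact_closedBall (0 : EuclideanSpace ℝ (Fin d)) (8 / 3)) fun ξ hξ => ?_
        have := P.base_support (subset_tsupport _ hξ)
        simpa using le_of_lt this.2
      exact hb.comp_smul (pow_ne_zero n (by norm_num))
  exact h.comp_left (g := fun r : ℝ => (r : ℂ)) Complex.ofReal_zero

/-- `symbol n = ρ_{n-1}` as a Schwartz function. -/
def symbolSchwartz {d : ℕ} (P : DyadicPartition d) (n : ℕ) : 𝓢(EuclideanSpace ℝ (Fin d), ℂ) :=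
  (P.symbol_compact n).toSchwartzMap (P.symbol_smooth n)

/-- The Littlewood-Paley block `Δ_{n-1} f = 𝓕⁻¹ (ρ_{n-1} 𝓕 f)` of a tempered distribution. -/
def block {d : ℕ} (P : DyadicPartition d) (n : ℕ) :
    𝓢'(EuclideanSpace ℝ (Fin d), ℂ) →L[ℂ] 𝓢'(EuclideanSpace ℝ (Fin d), ℂ) :=
  TemperedDistribution.fourierMultiplierCLM ℂ (fun ξ => (P.symbol n ξ : ℂ))

/-- The smooth function `x ↦ ⟨f, Q_{n-1}(x - ·)⟩`, with `Q_{n-1} = 𝓕⁻¹ ρ_{n-1}`, which represents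
the block `Δ_{n-1} f`. Note that `(𝓕 ρ_{n-1})(y - x) = Q_{n-1}(x - y)`. -/
def blockFun {d : ℕ} (P : DyadicPartition d) (n : ℕ) (f : 𝓢'(EuclideanSpace ℝ (Fin d), ℂ))
    (x : EuclideanSpace ℝ (Fin d)) : ℂ :=
  f (SchwartzMap.compSubConstCLM ℂ x (𝓕 (P.symbolSchwartz n)))

/-- The term `(∑_{-1 ≤ i ≤ j-2} Δ_i f) Δ_j g` of the paraproduct: the product of the tempered
distribution `Δ_j g` with a smooth function of temperate growth. -/
def paraTerm {d : ℕ} (P : DyadicPartition d) (f g : 𝓢'(EuclideanSpace ℝ (Fin d), ℂ)) (j : ℕ) :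
    𝓢'(EuclideanSpace ℝ (Fin d), ℂ) :=
  TemperedDistribution.smulLeftCLM ℂ (fun x => ∑ n ∈ Finset.range j, P.blockFun n f x)
    (P.block (j + 1) g)

/-- Convergence in `𝓢'` of the series that defines the paraproduct `P_f g`. -/
def ParaConverges {d : ℕ} (P : DyadicPartition d)
    (f g : 𝓢'(EuclideanSpace ℝ (Fin d), ℂ)) : Prop :=
  Summable (P.paraTerm f g)

/-- Bony's paraproduct `P_f g = ∑_{i ≤ j-2} Δ_i f Δ_j g`, as a sum in `𝓢'`. It is meaningful when
`ParaConverges` holds. (The term `j = 0` vanishes, as does the one of index `-1`.) -/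
def para {d : ℕ} (P : DyadicPartition d) (f g : 𝓢'(EuclideanSpace ℝ (Fin d), ℂ)) :
    𝓢'(EuclideanSpace ℝ (Fin d), ℂ) :=
  ∑' j, P.paraTerm f g j

end DyadicPartition

open Classical in
/-- A bounded measurable function on `ℝᵈ` as a tempered distribution. -/
def funDistribution {d : ℕ} (f : EuclideanSpace ℝ (Fin d) → ℝ) :
    𝓢'(EuclideanSpace ℝ (Fin d), ℂ) :=
  if h : MemLp (fun x => (f x : ℂ)) ⊤ volume then
    MeasureTheory.Lp.toTemperedDistribution (h.toLp _)
  else 0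

/-! ### The brackets -/

/-- The bracket `⟦τ⟧^g` of `τ ∈ 𝓑⁺`, defined by recursion on `|τ|` through
`g(τ) = ∑_{1 <⁺ ν <⁺ τ} P_{g(τ /⁺ ν)} ⟦ν⟧^g + ⟦τ⟧^g`. -/
def bracketBasis {d : ℕ} {Tp T : Type*} [Ring Tp] [HopfAlgebra ℝ Tp] [AddCommGroup T] [Module ℝ T]
    {S : ConcreteRegularityStructure Tp T} {ιp ι : Type*} (B : HomogeneousBases S ιp ι)
    (P : DyadicPartition d) (g : EuclideanSpace ℝ (Fin d) → Tp →ₐ[ℝ] ℝ)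
    (τ : ιp) : 𝓢'(EuclideanSpace ℝ (Fin d), ℂ) :=
  funDistribution (fun x => g x (B.basisP τ)) -
    ∑ ν ∈ (B.betweenP B.one τ).attach,
      P.para (funDistribution (fun x => g x (B.quotP τ ν.1))) (bracketBasis B P g ν.1)
termination_by B.rankP τ
decreasing_by exact B.rankP_lt ν.2

/-- The defining relation of the brackets. -/
theorem bracketBasis_spec {d : ℕ} {Tp T : Type*} [Ring Tp] [HopfAlgebra ℝ Tp]
    [AddCommGroup T] [Module ℝ T]
    {S : ConcreteRegularityStructure Tp T} {ιp ι : Type*} (B : HomogeneousBases S ιp ι)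
    (P : DyadicPartition d) (g : EuclideanSpace ℝ (Fin d) → Tp →ₐ[ℝ] ℝ) (τ : ιp) :
    funDistribution (fun x => g x (B.basisP τ)) =
      (∑ ν ∈ B.betweenP B.one τ,
        P.para (funDistribution (fun x => g x (B.quotP τ ν))) (bracketBasis B P g ν)) +
      bracketBasis B P g τ := by
  conv_rhs => rw [bracketBasis]
  rw [Finset.sum_attach (B.betweenP B.one τ) (fun ν =>
    P.para (funDistribution (fun x => g x (B.quotP τ ν))) (bracketBasis B P g ν))]
  abel

/-- The linear extension of the bracket `⟦·⟧^g` to `T⁺`. -/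
def bracket {d : ℕ} {Tp T : Type*} [Ring Tp] [HopfAlgebra ℝ Tp] [AddCommGroup T] [Module ℝ T]
    {S : ConcreteRegularityStructure Tp T} {ιp ι : Type*} (B : HomogeneousBases S ιp ι)
    (P : DyadicPartition d) (g : EuclideanSpace ℝ (Fin d) → Tp →ₐ[ℝ] ℝ) :
    Tp →ₗ[ℝ] 𝓢'(EuclideanSpace ℝ (Fin d), ℂ) :=
  B.basisP.constr ℝ (bracketBasis B P g)

end

noncomputable section

/-! Let `Ψ(a ⊗ b) = P_{g(b)} ⟦a⟧`. On basis elements of positive degree the recursion that defines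
the brackets says `g(t) = Ψ(Δ̃ t) + ⟦t⟧`, where `Δ̃ t = Δ⁺ t - t ⊗ 1 - 1 ⊗ t`. In this form both
sides are linear in `t`, so the identity holds for every homogeneous `t` of positive degree
(`IsModelMap.toDistribution_eq`), in particular for `t = τ/σ`, of degree `|τ| - |σ| > 0`. Comparing
coefficients in the comodule identity gives `Δ⁺(τ/σ) = ∑ (η/σ) ⊗ (τ/η)`. Removing the terms `η = τ`
and `η = σ` leaves `Δ̃(τ/σ)` as the sum over `σ < η < τ` (`reduced_comul_quot`), and applying `Ψ`
gives the claim.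

The analysis serves to make `Ψ` well defined and bilinear, that is, to show that all the series
converge. It takes place in `B⁰_{∞,∞}`, the space of distributions with uniformly bounded blocks
(`boundedBlocks`). If `f` is bounded and `h` lies in this space, the terms of `P_f h` are uniformly
bounded functions with spectrum in annuli of size `2^j`. Tested against a Schwartz function they are
therefore `O(2^{-j})` (`paraConverges`), and each block of the sum meets at most seven of them, so
`P_f h` stays in the space (`para_mem_boundedBlocks`). Induction along the recursion places every
bracket there. The Hölder-type bounds on `g_{yx}` enter only through the continuity of `x ↦ g_x(τ)`.
-/

/-! ### Fourier multipliers as convolutions -/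

/-- The convolution of Schwartz functions as an integral. -/
theorem SchwartzMap.convolution_mul_apply {d : ℕ} (K φ : 𝓢(EuclideanSpace ℝ (Fin d), ℂ))
    (y : EuclideanSpace ℝ (Fin d)) :
    SchwartzMap.convolution (ContinuousLinearMap.mul ℂ ℂ) K φ y = ∫ x, K (y - x) * φ x := by
  rw [SchwartzMap.convolution_apply, convolution_eq_swap]
  rfl

theorem SchwartzMap.fourier_apply_neg {d : ℕ} (f : 𝓢(EuclideanSpace ℝ (Fin d), ℂ))
    (x : EuclideanSpace ℝ (Fin d)) : 𝓕 f (-x) = 𝓕⁻ f x := by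
  rw [SchwartzMap.fourierInv_apply_eq]
  simp

theorem SchwartzMap.fourierInv_apply_neg {d : ℕ} (f : 𝓢(EuclideanSpace ℝ (Fin d), ℂ))
    (x : EuclideanSpace ℝ (Fin d)) : 𝓕⁻ f (-x) = 𝓕 f x := by
  rw [← SchwartzMap.fourier_apply_neg, neg_neg]

theorem SchwartzMap.fourier_fourier_apply {d : ℕ} (f : 𝓢(EuclideanSpace ℝ (Fin d), ℂ))
    (x : EuclideanSpace ℝ (Fin d)) : 𝓕 (𝓕 f) x = f (-x) := by
  rw [← SchwartzMap.fourierInv_apply_neg, FourierTransform.fourierInv_fourier_eq]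

/-- The multiplier with symbol `a` is the convolution with `𝓕 a`. -/
theorem SchwartzMap.fourier_smulLeft_fourierInv {d : ℕ}
    (a φ : 𝓢(EuclideanSpace ℝ (Fin d), ℂ)) :
    𝓕 (SchwartzMap.smulLeftCLM ℂ (⇑a) (𝓕⁻ φ)) =
      SchwartzMap.convolution (ContinuousLinearMap.mul ℂ ℂ) (𝓕 a) φ := by
  have h : 𝓕 (𝓕 (SchwartzMap.smulLeftCLM ℂ (⇑a) (𝓕⁻ φ))) =
      𝓕 (SchwartzMap.convolution (ContinuousLinearMap.mul ℂ ℂ) (𝓕 a) φ) := by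
    ext x
    rw [SchwartzMap.fourier_fourier_apply, SchwartzMap.fourier_convolution,
      SchwartzMap.smulLeftCLM_apply_apply a.hasTemperateGrowth,
      SchwartzMap.pairing_apply_apply, SchwartzMap.fourier_fourier_apply,
      SchwartzMap.fourierInv_apply_neg]
    rfl
  have h' := congrArg (fun f : 𝓢(EuclideanSpace ℝ (Fin d), ℂ) => 𝓕⁻ f) h
  simpa only [FourierTransform.fourierInv_fourier_eq] using h'

/-! ### Bounded functions as distributions -/

/-- The function `x ↦ ∫ K(y - x) u(y) dy`. -/
def smear {d : ℕ} (K u : EuclideanSpace ℝ (Fin d) → ℂ) (x : EuclideanSpace ℝ (Fin d)) : ℂ :=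
  ∫ y, K (y - x) * u y

section smear

variable {d : ℕ} {u : EuclideanSpace ℝ (Fin d) → ℂ} {C : ℝ}

theorem norm_smear_le {K : EuclideanSpace ℝ (Fin d) → ℂ} (hK : Integrable K)
    (hC : ∀ x, ‖u x‖ ≤ C) (x : EuclideanSpace ℝ (Fin d)) :
    ‖smear K u x‖ ≤ (∫ z, ‖K z‖) * C := by
  have h := norm_integral_le_of_norm_le (μ := volume) (f := fun y => K (y - x) * u y)
    (g := fun y => ‖K (y - x)‖ * C) ((hK.comp_sub_right x).norm.mul_const C)
    (ae_of_all _ fun y => by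
      rw [norm_mul]
      exact mul_le_mul_of_nonneg_left (hC y) (norm_nonneg _))
  refine h.trans (le_of_eq ?_)
  rw [integral_mul_const, integral_sub_right_eq_self (fun y => ‖K y‖) x]

theorem integrable_smear_prod {K φ : EuclideanSpace ℝ (Fin d) → ℂ} (hK : Integrable K)
    (hφ : Integrable φ) (hu : AEStronglyMeasurable u volume) (hC : ∀ x, ‖u x‖ ≤ C) :
    Integrable (fun p : EuclideanSpace ℝ (Fin d) × EuclideanSpace ℝ (Fin d) =>
      φ p.1 * (K (p.2 - p.1) * u p.2)) (volume.prod volume) := by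
  have h := (hφ.convolution_integrand (ContinuousLinearMap.mul ℂ ℂ) hK).swap
  have h2 := h.mul_bdd (hu.comp_snd (μ := volume)) (ae_of_all _ fun p => hC p.2)
  refine h2.congr (ae_of_all _ fun p => ?_)
  simp [mul_assoc]

theorem aestronglyMeasurable_smear {K : EuclideanSpace ℝ (Fin d) → ℂ} (hK : Integrable K)
    (hu : AEStronglyMeasurable u volume) : AEStronglyMeasurable (smear K u) volume := by
  have h : AEStronglyMeasurable
      (fun p : EuclideanSpace ℝ (Fin d) × EuclideanSpace ℝ (Fin d) => K (p.2 - p.1) * u p.2)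
      (volume.prod volume) := by
    refine AEStronglyMeasurable.mul ?_ (hu.comp_snd (μ := volume))
    exact ((aestronglyMeasurable_const (b := (1 : ℂ))).convolution_integrand
      (ContinuousLinearMap.mul ℂ ℂ) hK.1 (ν := volume)).prod_swap.congr
        (ae_of_all _ fun p => by simp)
  exact h.integral_prod_right'

/-- Smearing by `K` is the transpose of the convolution with `K`. -/
theorem integral_mul_smear (K φ : 𝓢(EuclideanSpace ℝ (Fin d), ℂ))
    (hu : AEStronglyMeasurable u volume) (hC : ∀ x, ‖u x‖ ≤ C) :
    ∫ x, φ x * smear K u x =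
      ∫ y, SchwartzMap.convolution (ContinuousLinearMap.mul ℂ ℂ) K φ y * u y := by
  have h := integral_integral_swap (μ := volume) (ν := volume)
    (f := fun x y => φ x * (K (y - x) * u y))
    (integrable_smear_prod K.integrable φ.integrable hu hC)
  simp only [integral_const_mul] at h
  refine h.trans (integral_congr_ae (ae_of_all _ fun y => ?_))
  dsimp only
  rw [SchwartzMap.convolution_mul_apply, ← integral_mul_const]
  refine integral_congr_ae (ae_of_all _ fun x => ?_)
  dsimp only
  ring

end smear

/-- The distribution `T` is given by a measurable function bounded by `C`. -/
def IsBoundedFunction {d : ℕ} (T : 𝓢'(EuclideanSpace ℝ (Fin d), ℂ)) (C : ℝ) : Prop :=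
  ∃ u : EuclideanSpace ℝ (Fin d) → ℂ, AEStronglyMeasurable u volume ∧ (∀ x, ‖u x‖ ≤ C) ∧
    ∀ φ : 𝓢(EuclideanSpace ℝ (Fin d), ℂ), T φ = ∫ x, φ x * u x

namespace IsBoundedFunction

variable {d : ℕ} {T T' : 𝓢'(EuclideanSpace ℝ (Fin d), ℂ)} {C C' : ℝ}

theorem nonneg (h : IsBoundedFunction T C) : 0 ≤ C := by
  obtain ⟨u, -, hC, -⟩ := h
  exact (norm_nonneg _).trans (hC 0)

theorem mono (h : IsBoundedFunction T C) (hC : C ≤ C') : IsBoundedFunction T C' := by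
  obtain ⟨u, hu, hb, hT⟩ := h
  exact ⟨u, hu, fun x => (hb x).trans hC, hT⟩

theorem zero : IsBoundedFunction (0 : 𝓢'(EuclideanSpace ℝ (Fin d), ℂ)) 0 :=
  ⟨0, aestronglyMeasurable_zero, by simp, fun φ => by simp⟩

theorem integrable_mul {u : EuclideanSpace ℝ (Fin d) → ℂ} (hu : AEStronglyMeasurable u volume)
    (hb : ∀ x, ‖u x‖ ≤ C) (φ : 𝓢(EuclideanSpace ℝ (Fin d), ℂ)) :
    Integrable (fun x => φ x * u x) :=
  φ.integrable.mul_bdd hu (ae_of_all _ hb)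

theorem add (h : IsBoundedFunction T C) (h' : IsBoundedFunction T' C') :
    IsBoundedFunction (T + T') (C + C') := by
  obtain ⟨u, hu, hb, hT⟩ := h
  obtain ⟨u', hu', hb', hT'⟩ := h'
  refine ⟨u + u', hu.add hu', fun x => (norm_add_le _ _).trans (add_le_add (hb x) (hb' x)),
    fun φ => ?_⟩
  simp only [Pi.add_apply, mul_add]
  rw [integral_add (integrable_mul hu hb φ) (integrable_mul hu' hb' φ), ← hT, ← hT']
  rfl

theorem smul (c : ℂ) (h : IsBoundedFunction T C) : IsBoundedFunction (c • T) (‖c‖ * C) := by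
  obtain ⟨u, hu, hb, hT⟩ := h
  refine ⟨c • u, hu.const_smul c, fun x => ?_, fun φ => ?_⟩
  · rw [Pi.smul_apply, norm_smul]
    exact mul_le_mul_of_nonneg_left (hb x) (norm_nonneg _)
  · have : (c • T) φ = c * T φ := rfl
    rw [this, hT, ← integral_const_mul]
    refine integral_congr_ae (ae_of_all _ fun x => ?_)
    simp only [Pi.smul_apply, smul_eq_mul]
    ring

theorem sum {κ : Type*} (s : Finset κ) {T : κ → 𝓢'(EuclideanSpace ℝ (Fin d), ℂ)} {C : ℝ}
    (h : ∀ k ∈ s, IsBoundedFunction (T k) C) :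
    IsBoundedFunction (∑ k ∈ s, T k) (s.card * C) := by
  classical
  induction s using Finset.induction_on with
  | empty => simpa using zero
  | insert a s ha ih =>
    rw [Finset.sum_insert ha, Finset.card_insert_of_notMem ha]
    refine ((h a (Finset.mem_insert_self _ _)).add
      (ih fun k hk => h k (Finset.mem_insert_of_mem hk))).mono (le_of_eq ?_)
    push_cast
    ring

theorem norm_apply_le (h : IsBoundedFunction T C) (φ : 𝓢(EuclideanSpace ℝ (Fin d), ℂ)) :
    ‖T φ‖ ≤ C * ∫ x, ‖φ x‖ := by
  obtain ⟨u, hu, hb, hT⟩ := h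
  rw [hT]
  refine (norm_integral_le_of_norm_le (g := fun x => C * ‖φ x‖)
    (φ.integrable.norm.const_mul C) (ae_of_all _ fun x => ?_)).trans (le_of_eq ?_)
  · rw [norm_mul, mul_comm]
    exact mul_le_mul_of_nonneg_right (hb x) (norm_nonneg _)
  · rw [integral_const_mul]

/-- The multiplier with symbol `a` maps bounded functions to bounded functions. -/
theorem fourierMultiplier (h : IsBoundedFunction T C) (a : 𝓢(EuclideanSpace ℝ (Fin d), ℂ)) :
    IsBoundedFunction (TemperedDistribution.fourierMultiplierCLM ℂ (⇑a) T)
      ((∫ z, ‖𝓕 a z‖) * C) := by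
  obtain ⟨u, hu, hb, hT⟩ := h
  refine ⟨smear (𝓕 a : 𝓢(EuclideanSpace ℝ (Fin d), ℂ)) u,
    aestronglyMeasurable_smear (𝓕 a).integrable hu,
    norm_smear_le (𝓕 a).integrable hb, fun φ => ?_⟩
  rw [integral_mul_smear (𝓕 a) φ hu hb, TemperedDistribution.fourierMultiplierCLM_apply_apply,
    SchwartzMap.fourier_smulLeft_fourierInv, hT]

end IsBoundedFunction

/-! ### Smoothness of smeared functions -/

theorem integrable_inv_one_add_norm_pow (d : ℕ) :
    Integrable (fun z : EuclideanSpace ℝ (Fin d) => ((1 + ‖z‖) ^ (d + 1))⁻¹) := by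
  have h := integrable_one_add_norm (E := EuclideanSpace ℝ (Fin d)) (μ := volume)
    (r := ((d + 1 : ℕ) : ℝ)) (by simp)
  refine h.congr (ae_of_all _ fun z => ?_)
  dsimp only
  rw [Real.rpow_neg (by positivity), Real.rpow_natCast]

theorem SchwartzMap.exists_norm_le_inv_one_add_norm_pow {d : ℕ} {V : Type*}
    [NormedAddCommGroup V] [NormedSpace ℝ V] (K : 𝓢(EuclideanSpace ℝ (Fin d), V)) (N : ℕ) :
    ∃ C, 0 ≤ C ∧ ∀ z, ‖K z‖ ≤ C * ((1 + ‖z‖) ^ N)⁻¹ := by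
  refine ⟨2 ^ N * ((Finset.Iic (N, 0)).sup fun m => SchwartzMap.seminorm ℝ m.1 m.2) K,
    by positivity, fun z => ?_⟩
  have h := SchwartzMap.one_add_le_sup_seminorm_apply (𝕜 := ℝ) (m := (N, 0)) (k := N) (n := 0)
    le_rfl le_rfl K z
  rw [norm_iteratedFDeriv_zero] at h
  rw [← div_eq_mul_inv, le_div_iff₀ (by positivity), mul_comm]
  exact h

/-- Peetre's inequality. It moves a polynomial weight from one point to another at the cost of a
weight in their difference. -/
theorem one_add_norm_le_mul {V : Type*} [SeminormedAddCommGroup V] (a b : V) :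
    1 + ‖a‖ ≤ (1 + ‖b‖) * (1 + ‖a - b‖) := by
  have h : ‖a‖ ≤ ‖b‖ + ‖a - b‖ := by
    simpa using norm_add_le b (a - b)
  nlinarith [norm_nonneg b, norm_nonneg (a - b)]

section smoothness

variable {d : ℕ} {u : EuclideanSpace ℝ (Fin d) → ℂ} {C : ℝ}

/-- The derivative falls on the kernel, so `u` need only be bounded and measurable. Vector-valued
kernels are allowed because `-DK` is again a Schwartz function, with values in linear maps, and the
lemma can be iterated. -/
theorem hasFDerivAt_integral_smul_comp_sub {V : Type*} [NormedAddCommGroup V] [NormedSpace ℝ V]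
    [NormedSpace ℂ V] [IsScalarTower ℝ ℂ V] [CompleteSpace V]
    (hu : AEStronglyMeasurable u volume) (hC : ∀ x, ‖u x‖ ≤ C)
    (K : 𝓢(EuclideanSpace ℝ (Fin d), V)) (x₀ : EuclideanSpace ℝ (Fin d)) :
    HasFDerivAt (fun x => ∫ y, u y • K (y - x))
      (∫ y, u y • (-SchwartzMap.fderivCLM ℝ _ V K) (y - x₀)) x₀ := by
  have hC0 : 0 ≤ C := (norm_nonneg _).trans (hC 0)
  obtain ⟨M, hM0, hM⟩ :=
    (-SchwartzMap.fderivCLM ℝ _ V K).exists_norm_le_inv_one_add_norm_pow (d + 1)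
  refine hasFDerivAt_integral_of_dominated_of_fderiv_le (Metric.ball_mem_nhds x₀ one_pos)
    (F := fun x y => u y • K (y - x))
    (F' := fun x y => u y • (-SchwartzMap.fderivCLM ℝ _ V K) (y - x))
    (bound := fun y => C * (M * 2 ^ (d + 1)) * ((1 + ‖y - x₀‖) ^ (d + 1))⁻¹) ?_ ?_ ?_ ?_ ?_ ?_
  · refine Filter.Eventually.of_forall fun x => hu.smul ?_
    exact (K.continuous.comp (continuous_id.sub continuous_const)).aestronglyMeasurable
  · exact (K.integrable.comp_sub_right x₀).bdd_smul C hu (ae_of_all _ hC)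
  · refine hu.smul ?_
    exact ((-SchwartzMap.fderivCLM ℝ _ V K).continuous.comp
      (continuous_id.sub continuous_const)).aestronglyMeasurable
  · refine ae_of_all _ fun y x hx => ?_
    rw [norm_smul, mul_assoc]
    refine mul_le_mul (hC y) ((hM _).trans ?_) (norm_nonneg _) hC0
    rw [mul_assoc]
    refine mul_le_mul_of_nonneg_left ?_ hM0
    -- Since `x` stays within distance `1` of `x₀`, the decay around `x` is dominated by decay
    -- around `x₀`, with a bound independent of `x`.
    have h1 : 1 + ‖y - x₀‖ ≤ 2 * (1 + ‖y - x‖) := by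
      have h2 := one_add_norm_le_mul (y - x₀) (y - x)
      have h3 : ‖y - x₀ - (y - x)‖ ≤ 1 := by
        rw [Metric.mem_ball, dist_eq_norm] at hx
        simpa using hx.le
      nlinarith [norm_nonneg (y - x)]
    rw [← div_eq_mul_inv, le_div_iff₀ (by positivity), ← div_eq_inv_mul,
      div_le_iff₀ (by positivity), ← mul_pow]
    exact pow_le_pow_left₀ (by positivity) h1 _
  · exact ((integrable_inv_one_add_norm_pow d).comp_sub_right x₀).const_mul _
  · refine ae_of_all _ fun y x _ => ?_
    have h := (K.hasFDerivAt (y - x)).comp x ((hasFDerivAt_const y x).sub (hasFDerivAt_id x))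
    have h' := h.const_smul (u y)
    convert h' using 1
    congr 1
    ext v
    simp [neg_apply, SchwartzMap.fderivCLM_apply]

/-- Each derivative replaces `K` by `-DK` and changes the target space, so the induction runs over
all `V` at once. -/
theorem contDiff_integral_smul_comp_sub (hu : AEStronglyMeasurable u volume)
    (hC : ∀ x, ‖u x‖ ≤ C) (n : ℕ) {V : Type} [NormedAddCommGroup V] [NormedSpace ℝ V]
    [NormedSpace ℂ V] [IsScalarTower ℝ ℂ V] [CompleteSpace V]
    (K : 𝓢(EuclideanSpace ℝ (Fin d), V)) :
    ContDiff ℝ n (fun x => ∫ y, u y • K (y - x)) ∧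
      ∃ M, ∀ x, ‖iteratedFDeriv ℝ n (fun x => ∫ y, u y • K (y - x)) x‖ ≤ M := by
  induction n generalizing V with
  | zero =>
    refine ⟨contDiff_zero.2 (continuous_iff_continuousAt.2 fun x =>
      (hasFDerivAt_integral_smul_comp_sub hu hC K x).continuousAt), C * ∫ y, ‖K y‖, fun x => ?_⟩
    rw [norm_iteratedFDeriv_zero, ← integral_sub_right_eq_self (fun y => ‖K y‖) x,
      ← integral_const_mul]
    refine norm_integral_le_of_norm_le ((K.integrable.comp_sub_right x).norm.const_mul C)
      (ae_of_all _ fun y => ?_)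
    rw [norm_smul]
    exact mul_le_mul_of_nonneg_right (hC y) (norm_nonneg _)
  | succ n ih =>
    have hd := hasFDerivAt_integral_smul_comp_sub hu hC K
    have hf : fderiv ℝ (fun x => ∫ y, u y • K (y - x)) =
        fun x => ∫ y, u y • (-SchwartzMap.fderivCLM ℝ _ V K) (y - x) :=
      funext fun x => (hd x).fderiv
    obtain ⟨h1, M, h2⟩ := ih (-SchwartzMap.fderivCLM ℝ _ V K)
    rw [← hf] at h1 h2
    refine ⟨?_, M, fun x => ?_⟩
    · push_cast
      exact contDiff_succ_iff_fderiv.2 ⟨fun x => (hd x).differentiableAt, by simp, h1⟩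
    · rw [← norm_iteratedFDeriv_fderiv]
      exact h2 x

/-- All derivatives are bounded, hence the growth exponent `0`. The products in `paraTerm` can be
evaluated pointwise only once this is known. -/
theorem hasTemperateGrowth_smear (hu : AEStronglyMeasurable u volume) (hC : ∀ x, ‖u x‖ ≤ C)
    (K : 𝓢(EuclideanSpace ℝ (Fin d), ℂ)) : (smear (⇑K) u).HasTemperateGrowth := by
  have h : smear (⇑K) u = fun x => ∫ y, u y • K (y - x) := by
    ext x
    simp only [smear, smul_eq_mul, mul_comm]
  rw [h]
  refine ⟨contDiff_infty.2 fun n => (contDiff_integral_smul_comp_sub hu hC n K).1, fun n => ?_⟩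
  obtain ⟨M, hM⟩ := (contDiff_integral_smul_comp_sub hu hC n K).2
  exact ⟨0, M, fun x => by simpa using hM x⟩

end smoothness

/-! ### Dilations -/

theorem Real.fourier_comp_smul {d : ℕ} (a : EuclideanSpace ℝ (Fin d) → ℂ) {t : ℝ} (ht : 0 < t)
    (z : EuclideanSpace ℝ (Fin d)) :
    𝓕 (fun ξ => a (t • ξ)) z = ((t ^ d)⁻¹ : ℝ) • 𝓕 a (t⁻¹ • z) := by
  rw [Real.fourier_eq, Real.fourier_eq]
  have h := Measure.integral_comp_smul (volume : Measure (EuclideanSpace ℝ (Fin d)))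
    (fun ξ => Real.fourierChar (-inner ℝ ξ (t⁻¹ • z)) • a ξ) t
  simp only [finrank_euclideanSpace, Fintype.card_fin] at h
  rw [abs_of_pos (by positivity)] at h
  rw [← h]
  refine integral_congr_ae (ae_of_all _ fun ξ => ?_)
  dsimp only
  rw [real_inner_smul_left, real_inner_smul_right, mul_inv_cancel_left₀ ht.ne']

theorem integral_dilation {d : ℕ} {F : Type*} [NormedAddCommGroup F] [NormedSpace ℝ F]
    (f : EuclideanSpace ℝ (Fin d) → F) {t : ℝ} (ht : 0 < t) :
    ∫ z, ((t ^ d)⁻¹ : ℝ) • f (t⁻¹ • z) = ∫ w, f w := by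
  rw [integral_smul, Measure.integral_comp_smul]
  simp only [finrank_euclideanSpace, Fintype.card_fin]
  rw [abs_of_pos (by positivity), smul_smul, inv_pow, inv_inv, inv_mul_cancel₀ (by positivity),
    one_smul]

/-- The `L¹` norm of the Fourier transform is invariant under dilations. -/
theorem integral_norm_fourier_comp_smul {d : ℕ} (a : EuclideanSpace ℝ (Fin d) → ℂ) {t : ℝ}
    (ht : 0 < t) : ∫ z, ‖𝓕 (fun ξ => a (t • ξ)) z‖ = ∫ w, ‖𝓕 a w‖ := by
  rw [← integral_dilation (fun w => ‖𝓕 a w‖) ht]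
  refine integral_congr_ae (ae_of_all _ fun z => ?_)
  dsimp only
  rw [Real.fourier_comp_smul a ht, norm_smul, Real.norm_of_nonneg (by positivity), smul_eq_mul]

/-! ### The symbols of a dyadic partition -/

namespace DyadicPartition

variable {d : ℕ} (P : DyadicPartition d)

@[simp]
theorem symbolSchwartz_apply (n : ℕ) (ξ : EuclideanSpace ℝ (Fin d)) :
    P.symbolSchwartz n ξ = (P.symbol n ξ : ℂ) :=
  rfl

theorem norm_lt_of_low_ne_zero {ξ : EuclideanSpace ℝ (Fin d)} (h : P.low ξ ≠ 0) :
    ‖ξ‖ < 4 / 3 :=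
  P.low_support (subset_tsupport _ h)

theorem norm_mem_of_base_ne_zero {ξ : EuclideanSpace ℝ (Fin d)} (h : P.base ξ ≠ 0) :
    3 / 4 < ‖ξ‖ ∧ ‖ξ‖ < 8 / 3 :=
  P.base_support (subset_tsupport _ h)

/-- The annuli avoid the origin, so `ρ₋₁` alone carries the partition of unity there. -/
theorem low_zero : P.low 0 = 1 := by
  have h0 : P.base 0 = 0 := by
    by_contra h
    have := (P.norm_mem_of_base_ne_zero h).1
    norm_num at this
  have h := P.sum_eq_one 0
  simp only [smul_zero, h0] at h
  have := h.unique hasSum_zero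
  linarith

theorem low_neg (ξ : EuclideanSpace ℝ (Fin d)) : P.low (-ξ) = P.low ξ :=
  P.low_radial _ _ (norm_neg ξ)

/-- `∑_{-1 ≤ i < k} ρ_i = ρ₋₁(2^{-k} ·)`. -/
theorem sum_symbol (k : ℕ) (ξ : EuclideanSpace ℝ (Fin d)) :
    ∑ n ∈ Finset.range (k + 1), P.symbol n ξ = P.low ((2 : ℝ)⁻¹ ^ k • ξ) := by
  have h1 := P.sum_eq_one ξ
  have h2 := P.sum_eq_one ((2 : ℝ)⁻¹ ^ k • ξ)
  -- The tail of the series at `ξ` is the whole series at `2^{-k} ξ`; equating the two sums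
  -- telescopes the partition.
  have h3 := (hasSum_nat_add_iff' k).2 h1
  have h4 : (fun n : ℕ => P.base ((2 : ℝ)⁻¹ ^ n • (2 : ℝ)⁻¹ ^ k • ξ)) =
      fun n : ℕ => P.base ((2 : ℝ)⁻¹ ^ (n + k) • ξ) := by
    ext n
    rw [smul_smul, ← pow_add]
  rw [h4] at h2
  have h5 := h2.unique h3
  rw [Finset.sum_range_succ']
  simp only [symbol]
  linarith

/-- The dilated symbol `ρ₋₁(t ·)` as a Schwartz function. -/
def lowDilation {t : ℝ} (ht : 0 < t) : 𝓢(EuclideanSpace ℝ (Fin d), ℂ) :=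
  SchwartzMap.compCLMOfContinuousLinearEquiv ℂ
    (ContinuousLinearEquiv.smulLeft (R₁ := ℝ) (Units.mk0 t ht.ne')) (P.symbolSchwartz 0)

theorem lowDilation_apply {t : ℝ} (ht : 0 < t) (ξ : EuclideanSpace ℝ (Fin d)) :
    P.lowDilation ht ξ = (P.low (t • ξ) : ℂ) :=
  rfl

theorem sum_symbolSchwartz (k : ℕ) :
    ∑ n ∈ Finset.range (k + 1), P.symbolSchwartz n =
      P.lowDilation (t := (2 : ℝ)⁻¹ ^ k) (by positivity) := by
  ext ξ
  rw [lowDilation_apply, ← P.sum_symbol, sum_apply, Complex.ofReal_sum]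
  rfl

theorem integral_norm_fourier_lowDilation {t : ℝ} (ht : 0 < t) :
    ∫ z, ‖𝓕 (P.lowDilation ht) z‖ = ∫ w, ‖𝓕 (P.symbolSchwartz 0) w‖ :=
  integral_norm_fourier_comp_smul (⇑(P.symbolSchwartz 0)) ht

/-- The kernels of the Littlewood-Paley blocks are bounded in `L¹`. -/
theorem exists_integral_norm_fourier_symbol_le :
    ∃ L, ∀ n, ∫ z, ‖𝓕 (P.symbolSchwartz n) z‖ ≤ L := by
  refine ⟨max (∫ z, ‖𝓕 (P.symbolSchwartz 0) z‖) (∫ z, ‖𝓕 (P.symbolSchwartz 1) z‖), fun n => ?_⟩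
  cases n with
  | zero => exact le_max_left _ _
  | succ n =>
    refine le_trans (le_of_eq ?_) (le_max_right _ _)
    have h := integral_norm_fourier_comp_smul (fun ξ => (P.base ξ : ℂ))
      (t := (2 : ℝ)⁻¹ ^ n) (by positivity)
    have h1 : (⇑(P.symbolSchwartz 1) : EuclideanSpace ℝ (Fin d) → ℂ) =
        fun ξ => (P.base ξ : ℂ) := by
      ext ξ
      simp [symbol]
    have h2 : ∫ z, ‖𝓕 (P.symbolSchwartz 1) z‖ = ∫ z, ‖𝓕 (fun ξ => (P.base ξ : ℂ)) z‖ := by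
      rw [← h1]
      rfl
    rw [h2, ← h]
    rfl

/-- The sum of the first blocks is a smeared function. -/
theorem sum_blockFun (f : 𝓢'(EuclideanSpace ℝ (Fin d), ℂ)) (k : ℕ)
    (x : EuclideanSpace ℝ (Fin d)) :
    ∑ n ∈ Finset.range (k + 1), P.blockFun n f x =
      f (SchwartzMap.compSubConstCLM ℂ x
        (𝓕 (P.lowDilation (t := (2 : ℝ)⁻¹ ^ k) (by positivity)))) := by
  have h : 𝓕 (∑ n ∈ Finset.range (k + 1), P.symbolSchwartz n) =
      ∑ n ∈ Finset.range (k + 1), 𝓕 (P.symbolSchwartz n) :=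
    map_sum (FourierTransform.fourierCLM ℂ 𝓢(EuclideanSpace ℝ (Fin d), ℂ)) _ _
  rw [← sum_symbolSchwartz, h, map_sum, map_sum]
  rfl

theorem norm_lt_of_symbol_zero_ne_zero {ξ : EuclideanSpace ℝ (Fin d)} (h : P.symbol 0 ξ ≠ 0) :
    ‖ξ‖ < 4 / 3 :=
  P.norm_lt_of_low_ne_zero h

theorem norm_mem_of_symbol_succ_ne_zero {n : ℕ} {ξ : EuclideanSpace ℝ (Fin d)}
    (h : P.symbol (n + 1) ξ ≠ 0) :
    3 / 4 < (2 : ℝ)⁻¹ ^ n * ‖ξ‖ ∧ (2 : ℝ)⁻¹ ^ n * ‖ξ‖ < 8 / 3 := by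
  have := P.norm_mem_of_base_ne_zero h
  rwa [norm_smul, Real.norm_of_nonneg (by positivity)] at this

end DyadicPartition

/-! ### Frequency localization of products -/

/-- The modulation `x ↦ exp(2πi⟨x, ξ⟩) ψ(x)`. -/
def modulation {d : ℕ} (ξ : EuclideanSpace ℝ (Fin d)) (ψ : 𝓢(EuclideanSpace ℝ (Fin d), ℂ)) :
    𝓢(EuclideanSpace ℝ (Fin d), ℂ) :=
  𝓕⁻ (SchwartzMap.compSubConstCLM ℂ ξ (𝓕 ψ))

theorem fourier_modulation {d : ℕ} (ξ : EuclideanSpace ℝ (Fin d))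
    (ψ : 𝓢(EuclideanSpace ℝ (Fin d), ℂ)) (t : EuclideanSpace ℝ (Fin d)) :
    𝓕 (modulation ξ ψ) t = 𝓕 ψ (t - ξ) := by
  rw [modulation, FourierTransform.fourier_fourierInv_eq]
  rfl

/-- Defining the modulation as a translation in frequency makes it a Schwartz function at once; the
pointwise formula is recovered here. -/
theorem modulation_apply {d : ℕ} (ξ : EuclideanSpace ℝ (Fin d))
    (ψ : 𝓢(EuclideanSpace ℝ (Fin d), ℂ)) (x : EuclideanSpace ℝ (Fin d)) :
    modulation ξ ψ x = Real.fourierChar (inner ℝ x ξ) • ψ x := by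
  have h : ψ x = 𝓕⁻ (𝓕 ψ) x := by rw [FourierTransform.fourierInv_fourier_eq]
  rw [h, modulation, SchwartzMap.fourierInv_coe, SchwartzMap.fourierInv_coe, Real.fourierInv_eq,
    Real.fourierInv_eq, ← integral_add_right_eq_self _ ξ, Circle.smul_def, ← integral_smul]
  refine integral_congr_ae (ae_of_all _ fun t => ?_)
  simp only [SchwartzMap.compSubConstCLM_apply, add_sub_cancel_right, inner_add_left,
    AddChar.map_add_eq_mul, Circle.smul_def, Circle.coe_mul, smul_eq_mul]
  rw [real_inner_comm ξ x]
  ring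

/-- If the symbols `A` and `𝓕 ψ(· - ξ)` have disjoint supports, then the frequency `ξ` does not
appear in the product of `ψ` with a function whose frequencies lie in the support of `A`. -/
theorem fourierInv_smulLeft_smear_eq_zero {d : ℕ} {u : EuclideanSpace ℝ (Fin d) → ℂ} {C : ℝ}
    (hu : AEStronglyMeasurable u volume) (hC : ∀ x, ‖u x‖ ≤ C)
    (A ψ : 𝓢(EuclideanSpace ℝ (Fin d), ℂ)) (ξ : EuclideanSpace ℝ (Fin d))
    (h : ∀ t, A (-t) ≠ 0 → 𝓕 ψ (t - ξ) = 0) :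
    𝓕⁻ (SchwartzMap.smulLeftCLM ℂ (smear (𝓕 A : 𝓢(EuclideanSpace ℝ (Fin d), ℂ)) u) ψ) ξ = 0 := by
  -- The value at frequency `ξ` is the smeared function tested against a modulation of `ψ`.
  have h1 : 𝓕⁻ (SchwartzMap.smulLeftCLM ℂ
      (smear (𝓕 A : 𝓢(EuclideanSpace ℝ (Fin d), ℂ)) u) ψ) ξ =
      ∫ x, modulation ξ ψ x * smear (𝓕 A : 𝓢(EuclideanSpace ℝ (Fin d), ℂ)) u x := by
    rw [SchwartzMap.fourierInv_coe, Real.fourierInv_eq]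
    refine integral_congr_ae (ae_of_all _ fun x => ?_)
    dsimp only
    rw [SchwartzMap.smulLeftCLM_apply_apply (hasTemperateGrowth_smear hu hC (𝓕 A)),
      modulation_apply, Circle.smul_def, Circle.smul_def]
    simp only [smul_eq_mul]
    ring
  -- Moving the smearing onto the test function produces this convolution, whose Fourier transform
  -- is `A(-t) 𝓕ψ(t - ξ)`.
  have h2 : SchwartzMap.convolution (ContinuousLinearMap.mul ℂ ℂ) (𝓕 A) (modulation ξ ψ) = 0 := by
    have h3 : 𝓕 (SchwartzMap.convolution (ContinuousLinearMap.mul ℂ ℂ) (𝓕 A)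
        (modulation ξ ψ)) = 0 := by
      ext t
      rw [SchwartzMap.fourier_convolution, SchwartzMap.pairing_apply_apply, fourier_modulation,
        SchwartzMap.fourier_fourier_apply]
      by_cases ht : A (-t) = 0
      · simp [ht]
      · simp [h t ht]
    have h4 := congrArg (fun f : 𝓢(EuclideanSpace ℝ (Fin d), ℂ) => 𝓕⁻ f) h3
    simp only [FourierTransform.fourierInv_fourier_eq] at h4
    rw [h4]
    exact map_zero (FourierTransform.fourierInvCLM ℂ 𝓢(EuclideanSpace ℝ (Fin d), ℂ))
  rw [h1, integral_mul_smear (𝓕 A) (modulation ξ ψ) hu hC, h2]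
  simp

/-! ### The terms of the paraproduct -/

namespace DyadicPartition

variable {d : ℕ} (P : DyadicPartition d) {f h : 𝓢'(EuclideanSpace ℝ (Fin d), ℂ)} {C C' : ℝ}

theorem hasTemperateGrowth_symbol (n : ℕ) :
    (fun ξ => (P.symbol n ξ : ℂ)).HasTemperateGrowth :=
  (P.symbolSchwartz n).hasTemperateGrowth

theorem blockFun_eq_smear {u : EuclideanSpace ℝ (Fin d) → ℂ}
    (hf : ∀ φ : 𝓢(EuclideanSpace ℝ (Fin d), ℂ), f φ = ∫ x, φ x * u x) (n : ℕ) :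
    P.blockFun n f = smear (𝓕 (P.symbolSchwartz n) : 𝓢(EuclideanSpace ℝ (Fin d), ℂ)) u := by
  ext x
  rw [blockFun, hf]
  rfl

theorem sum_blockFun_eq_smear {u : EuclideanSpace ℝ (Fin d) → ℂ}
    (hf : ∀ φ : 𝓢(EuclideanSpace ℝ (Fin d), ℂ), f φ = ∫ x, φ x * u x) (k : ℕ) :
    (fun x => ∑ n ∈ Finset.range (k + 1), P.blockFun n f x) =
      smear (𝓕 (P.lowDilation (t := (2 : ℝ)⁻¹ ^ k) (by positivity)) :
        𝓢(EuclideanSpace ℝ (Fin d), ℂ)) u := by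
  ext x
  rw [sum_blockFun, hf]
  rfl

theorem hasTemperateGrowth_blockFun (hf : IsBoundedFunction f C) (n : ℕ) :
    (P.blockFun n f).HasTemperateGrowth := by
  obtain ⟨u, hu, hb, hf⟩ := hf
  rw [P.blockFun_eq_smear hf]
  exact hasTemperateGrowth_smear hu hb _

theorem hasTemperateGrowth_sum_blockFun (hf : IsBoundedFunction f C) (j : ℕ) :
    (fun x => ∑ n ∈ Finset.range j, P.blockFun n f x).HasTemperateGrowth :=
  Function.HasTemperateGrowth.sum fun n _ => P.hasTemperateGrowth_blockFun hf n

theorem paraTerm_apply (j : ℕ) (φ : 𝓢(EuclideanSpace ℝ (Fin d), ℂ)) :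
    P.paraTerm f h j φ = P.block (j + 1) h
      (SchwartzMap.smulLeftCLM ℂ (fun x => ∑ n ∈ Finset.range j, P.blockFun n f x) φ) :=
  rfl

@[simp]
theorem paraTerm_zero : P.paraTerm f h 0 = 0 := by
  ext φ
  rw [paraTerm_apply]
  simp

/-- Bounding the low blocks one by one would cost a factor `j`. Their sum is a single dilated
low-pass filter, whose kernel has `L¹` norm independent of `j`. -/
theorem isBoundedFunction_paraTerm (hf : IsBoundedFunction f C) {j : ℕ}
    (hh : IsBoundedFunction (P.block (j + 1) h) C') :
    IsBoundedFunction (P.paraTerm f h j)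
      ((∫ z, ‖𝓕 (P.symbolSchwartz 0) z‖) * C * C') := by
  have hL : 0 ≤ ∫ z, ‖𝓕 (P.symbolSchwartz 0) z‖ := integral_nonneg fun _ => norm_nonneg _
  cases j with
  | zero =>
    rw [paraTerm_zero]
    exact IsBoundedFunction.zero.mono (mul_nonneg (mul_nonneg hL hf.nonneg) hh.nonneg)
  | succ k =>
    have ht := P.hasTemperateGrowth_sum_blockFun hf (k + 1)
    have hC0 := hf.nonneg
    obtain ⟨u, hu, hb, hf⟩ := hf
    obtain ⟨v, hv, hb', hh⟩ := hh
    have hF := P.sum_blockFun_eq_smear hf k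
    refine ⟨fun x => (∑ n ∈ Finset.range (k + 1), P.blockFun n f x) * v x, ?_, fun x => ?_,
      fun φ => ?_⟩
    · rw [hF] at ht
      have h1 := ht.1.continuous.aestronglyMeasurable.mul hv (μ := volume)
      rw [← hF] at h1
      exact h1
    · rw [norm_mul, congrFun hF x, ← P.integral_norm_fourier_lowDilation (t := (2 : ℝ)⁻¹ ^ k)
        (by positivity)]
      exact mul_le_mul (norm_smear_le (SchwartzMap.integrable _) hb x) (hb' x) (norm_nonneg _)
        (mul_nonneg (integral_nonneg fun _ => norm_nonneg _) hC0)
    · rw [paraTerm_apply, hh]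
      refine integral_congr_ae (ae_of_all _ fun x => ?_)
      dsimp only
      rw [SchwartzMap.smulLeftCLM_apply_apply ht, smul_eq_mul]
      ring

/-- The spectrum of a term of the paraproduct lies in an annulus. -/
theorem paraTerm_multiplier_eq_zero (hf : IsBoundedFunction f C) (k : ℕ)
    (a φ : 𝓢(EuclideanSpace ℝ (Fin d), ℂ))
    (ha : ∀ η, 1 / 6 < (2 : ℝ)⁻¹ ^ k * ‖η‖ → (2 : ℝ)⁻¹ ^ k * ‖η‖ < 20 / 3 → a η = 0) :
    P.paraTerm f h (k + 1) (𝓕 (SchwartzMap.smulLeftCLM ℂ (⇑a) (𝓕⁻ φ))) = 0 := by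
  obtain ⟨u, hu, hb, hf⟩ := hf
  set ψ := 𝓕 (SchwartzMap.smulLeftCLM ℂ (⇑a) (𝓕⁻ φ)) with hψ
  rw [paraTerm_apply, P.sum_blockFun_eq_smear hf, block,
    TemperedDistribution.fourierMultiplierCLM_apply_apply]
  -- After scaling by `2^{-k}`, the low-pass factor has frequencies below `4/3` and the block
  -- `ρ_{k+1}` has frequencies in `(3/2, 16/3)`. Their sums lie in `(3/2 - 4/3, 16/3 + 4/3) = (1/6,
  -- 20/3)`, where `a` vanishes.
  have key : SchwartzMap.smulLeftCLM ℂ (fun ξ => (P.symbol (k + 1 + 1) ξ : ℂ))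
      (𝓕⁻ (SchwartzMap.smulLeftCLM ℂ (smear (𝓕 (P.lowDilation (t := (2 : ℝ)⁻¹ ^ k)
        (by positivity)) : 𝓢(EuclideanSpace ℝ (Fin d), ℂ)) u) ψ)) = 0 := by
    ext ξ
    rw [SchwartzMap.smulLeftCLM_apply_apply (P.hasTemperateGrowth_symbol (k + 1 + 1))]
    by_cases hξ : P.symbol (k + 1 + 1) ξ = 0
    · simp [hξ]
    · rw [fourierInv_smulLeft_smear_eq_zero hu hb _ _ ξ, smul_zero]
      · rfl
      intro t ht
      rw [lowDilation_apply, smul_neg, low_neg] at ht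
      have h1 := P.norm_lt_of_low_ne_zero (fun h0 => ht (by rw [h0]; rfl))
      rw [norm_smul, Real.norm_of_nonneg (by positivity)] at h1
      have h2 := P.norm_mem_of_symbol_succ_ne_zero hξ
      rw [pow_succ] at h2
      rw [hψ, SchwartzMap.fourier_fourier_apply,
        SchwartzMap.smulLeftCLM_apply_apply a.hasTemperateGrowth, ha, zero_smul]
      · rw [norm_neg]
        have h3 : ‖ξ‖ ≤ ‖t‖ + ‖t - ξ‖ := by
          rw [norm_sub_rev]
          simpa using norm_add_le t (ξ - t)
        have h4 := mul_le_mul_of_nonneg_left h3 (show (0 : ℝ) ≤ 2⁻¹ ^ k by positivity)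
        linarith
      · rw [norm_neg]
        have h4 := mul_le_mul_of_nonneg_left (norm_sub_le t ξ)
          (show (0 : ℝ) ≤ 2⁻¹ ^ k by positivity)
        linarith
  rw [key]
  have h0 : 𝓕 (0 : 𝓢(EuclideanSpace ℝ (Fin d), ℂ)) = 0 :=
    map_zero (FourierTransform.fourierCLM ℂ 𝓢(EuclideanSpace ℝ (Fin d), ℂ))
  rw [h0, map_zero]

/-- The annulus `2^k (1/6, 20/3)` misses the support of `ρ_{n-1}`. For small `n ≥ 1` this is `2^{-4}
· 8/3 = 1/6`, and for `n = 0` it is `2^{-3} · 4/3 = 1/6`. For large `n` it is `2^4 · 3/4 = 12 >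
20/3`; one power of two less would give only `6`. -/
theorem block_paraTerm_eq_zero (hf : IsBoundedFunction f C) {n k : ℕ}
    (hnk : n + 3 ≤ k ∨ k + 5 ≤ n) : P.block n (P.paraTerm f h (k + 1)) = 0 := by
  ext φ
  have h1 : P.block n (P.paraTerm f h (k + 1)) φ = P.paraTerm f h (k + 1)
      (𝓕 (SchwartzMap.smulLeftCLM ℂ (⇑(P.symbolSchwartz n)) (𝓕⁻ φ))) := rfl
  rw [h1, P.paraTerm_multiplier_eq_zero hf]
  · rfl
  intro η h2 h3
  by_contra h4
  rw [symbolSchwartz_apply] at h4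
  have h5 : P.symbol n η ≠ 0 := fun h0 => h4 (by rw [h0]; rfl)
  have hk : (2 : ℝ)⁻¹ ^ k * 2 ^ k = 1 := by rw [← mul_pow]; norm_num
  have hη := norm_nonneg η
  cases n with
  | zero =>
    have h6 := P.norm_lt_of_symbol_zero_ne_zero h5
    have hk3 : 3 ≤ k := by omega
    have h7 : (2 : ℝ)⁻¹ ^ k ≤ 2⁻¹ ^ 3 := pow_le_pow_of_le_one (by norm_num) (by norm_num) hk3
    have h8 : (2 : ℝ)⁻¹ ^ k * ‖η‖ ≤ 2⁻¹ ^ 3 * (4 / 3) :=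
      mul_le_mul h7 h6.le hη (by norm_num)
    norm_num at h8
    linarith
  | succ n =>
    obtain ⟨h6, h7⟩ := P.norm_mem_of_symbol_succ_ne_zero h5
    rcases hnk with hnk | hnk
    · have h8 : (2 : ℝ)⁻¹ ^ k ≤ 2⁻¹ ^ (n + 4) :=
        pow_le_pow_of_le_one (by norm_num) (by norm_num) (by omega)
      have h9 := mul_le_mul_of_nonneg_right h8 hη
      rw [pow_add] at h9
      norm_num at h9
      norm_num at h2 h7
      linarith
    · have h8 : (2 : ℝ)⁻¹ ^ n ≤ 2⁻¹ ^ (k + 4) :=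
        pow_le_pow_of_le_one (by norm_num) (by norm_num) (by omega)
      have h9 := mul_le_mul_of_nonneg_right h8 hη
      rw [pow_add] at h9
      norm_num at h9
      norm_num at h3 h6
      linarith

end DyadicPartition

/-! ### High frequencies of Schwartz functions -/

/-- Mean value inequality on the ball of radius `‖v‖` around `x`; Peetre's inequality turns the
decay of `Dφ` at points of the ball into decay in `x`. -/
theorem SchwartzMap.norm_sub_comp_sub_le {d : ℕ} (φ : 𝓢(EuclideanSpace ℝ (Fin d), ℂ)) (N : ℕ)
    (x v : EuclideanSpace ℝ (Fin d)) :
    ‖φ x - φ (x - v)‖ ≤ 2 ^ N *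
      ((Finset.Iic (N, 1)).sup (schwartzSeminormFamily ℂ (EuclideanSpace ℝ (Fin d)) ℂ)) φ *
      ((1 + ‖x‖) ^ N)⁻¹ * ((1 + ‖v‖) ^ N * ‖v‖) := by
  set q := ((Finset.Iic (N, 1)).sup
    (schwartzSeminormFamily ℂ (EuclideanSpace ℝ (Fin d)) ℂ)) φ with hq
  have h := Convex.norm_image_sub_le_of_norm_fderiv_le (𝕜 := ℝ) (f := φ)
    (C := 2 ^ N * q * ((1 + ‖x‖) ^ N)⁻¹ * (1 + ‖v‖) ^ N)
    (s := Metric.closedBall x ‖v‖) (x := x - v) (y := x) (fun z _ => φ.differentiableAt)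
    (fun z hz => ?_) (convex_closedBall x ‖v‖) (by simp) (by simp)
  · rwa [sub_sub_cancel, mul_assoc] at h
  · have h1 := SchwartzMap.one_add_le_sup_seminorm_apply (𝕜 := ℂ) (m := (N, 1)) (k := N) (n := 1)
      le_rfl le_rfl φ z
    rw [norm_iteratedFDeriv_one] at h1
    change _ ≤ 2 ^ N * q at h1
    have h2 : 1 + ‖x‖ ≤ (1 + ‖z‖) * (1 + ‖v‖) := by
      refine (one_add_norm_le_mul x z).trans (mul_le_mul_of_nonneg_left ?_ (by positivity))
      rw [Metric.mem_closedBall, dist_eq_norm, norm_sub_rev] at hz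
      linarith
    have h3 := pow_le_pow_left₀ (by positivity) h2 N
    rw [mul_pow] at h3
    rw [mul_right_comm, ← div_eq_mul_inv, le_div_iff₀ (by positivity)]
    calc ‖fderiv ℝ φ z‖ * (1 + ‖x‖) ^ N
        ≤ ‖fderiv ℝ φ z‖ * ((1 + ‖z‖) ^ N * (1 + ‖v‖) ^ N) :=
          mul_le_mul_of_nonneg_left h3 (norm_nonneg _)
      _ = (1 + ‖z‖) ^ N * ‖fderiv ℝ φ z‖ * (1 + ‖v‖) ^ N := by ring
      _ ≤ _ := mul_le_mul_of_nonneg_right h1 (by positivity)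

theorem SchwartzMap.integrable_norm_mul_one_add_norm_pow {d : ℕ}
    (K : 𝓢(EuclideanSpace ℝ (Fin d), ℂ)) (N : ℕ) :
    Integrable (fun w => ‖K w‖ * (1 + ‖w‖) ^ N) := by
  obtain ⟨C, hC0, hC⟩ := K.exists_norm_le_inv_one_add_norm_pow (N + (d + 1))
  refine ((integrable_inv_one_add_norm_pow d).const_mul C).mono' ?_ (ae_of_all _ fun w => ?_)
  · have := K.continuous
    exact (by fun_prop : Continuous fun w => ‖K w‖ * (1 + ‖w‖) ^ N).aestronglyMeasurable
  · rw [Real.norm_of_nonneg (by positivity), ← le_div_iff₀ (by positivity)]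
    refine (hC w).trans (le_of_eq ?_)
    rw [pow_add, mul_inv]
    field_simp

namespace DyadicPartition

variable {d : ℕ} (P : DyadicPartition d)

/-- The integral is the inverse transform at `0`, hence `ρ₋₁(0)`. Low-pass filters thus preserve
constants, and `φ` minus its filtered version is an average of increments of `φ`. -/
theorem integral_fourier_low : ∫ w, 𝓕 (P.symbolSchwartz 0) w = 1 := by
  have h : 𝓕⁻ (𝓕 (P.symbolSchwartz 0)) 0 = 1 := by
    rw [FourierTransform.fourierInv_fourier_eq, symbolSchwartz_apply]
    simp [symbol, P.low_zero]
  rw [SchwartzMap.fourierInv_coe, Real.fourierInv_eq] at h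
  simpa using h

theorem convolution_fourier_lowDilation {t : ℝ} (ht : 0 < t)
    (φ : 𝓢(EuclideanSpace ℝ (Fin d), ℂ)) (x : EuclideanSpace ℝ (Fin d)) :
    SchwartzMap.convolution (ContinuousLinearMap.mul ℂ ℂ) (𝓕 (P.lowDilation ht)) φ x =
      ∫ w, 𝓕 (P.symbolSchwartz 0) w * φ (x - t • w) := by
  rw [SchwartzMap.convolution_apply, convolution_def,
    ← integral_dilation (fun w => 𝓕 (P.symbolSchwartz 0) w * φ (x - t • w)) ht]
  refine integral_congr_ae (ae_of_all _ fun z => ?_)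
  have h : 𝓕 (P.lowDilation ht) z = ((t ^ d)⁻¹ : ℝ) • 𝓕 (P.symbolSchwartz 0) (t⁻¹ • z) :=
    Real.fourier_comp_smul (⇑(P.symbolSchwartz 0)) ht z
  dsimp only
  rw [smul_inv_smul₀ ht.ne', ContinuousLinearMap.mul_apply', h, smul_mul_assoc]

/-- The high frequency part of a Schwartz function is small in `L¹`. -/
theorem exists_integral_norm_sub_convolution_le :
    ∃ M, 0 ≤ M ∧ ∀ (t : ℝ) (ht : 0 < t), t ≤ 8 → ∀ φ : 𝓢(EuclideanSpace ℝ (Fin d), ℂ),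
      ∫ x, ‖(φ - SchwartzMap.convolution (ContinuousLinearMap.mul ℂ ℂ)
        (𝓕 (P.lowDilation ht)) φ) x‖ ≤
      t * M * ((Finset.Iic (d + 1, 1)).sup
        (schwartzSeminormFamily ℂ (EuclideanSpace ℝ (Fin d)) ℂ)) φ := by
  set K := 𝓕 (P.symbolSchwartz 0) with hK
  set J := ∫ w, ‖K w‖ * (1 + ‖w‖) ^ (d + 2) with hJ
  set I := ∫ x : EuclideanSpace ℝ (Fin d), ((1 + ‖x‖) ^ (d + 1))⁻¹ with hI
  have hJ0 : 0 ≤ J := integral_nonneg fun w => by positivity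
  have hI0 : 0 ≤ I := integral_nonneg fun w => by positivity
  refine ⟨2 ^ (d + 1) * 8 ^ (d + 1) * J * I, by positivity, fun t ht ht8 φ => ?_⟩
  set q := ((Finset.Iic (d + 1, 1)).sup
    (schwartzSeminormFamily ℂ (EuclideanSpace ℝ (Fin d)) ℂ)) φ with hq
  have hq0 : 0 ≤ q := apply_nonneg _ _
  have hpt : ∀ x, ‖(φ - SchwartzMap.convolution (ContinuousLinearMap.mul ℂ ℂ)
      (𝓕 (P.lowDilation ht)) φ) x‖ ≤
      t * (2 ^ (d + 1) * 8 ^ (d + 1) * J) * q * ((1 + ‖x‖) ^ (d + 1))⁻¹ := by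
    intro x
    have hint : Integrable (fun w => K w * φ (x - t • w)) := by
      refine K.integrable.mul_bdd (c := SchwartzMap.seminorm ℝ 0 0 φ) ?_
        (ae_of_all _ fun w => SchwartzMap.norm_le_seminorm ℝ φ _)
      exact (φ.continuous.comp (by fun_prop)).aestronglyMeasurable
    have h1 : (φ - SchwartzMap.convolution (ContinuousLinearMap.mul ℂ ℂ)
        (𝓕 (P.lowDilation ht)) φ) x = ∫ w, K w * (φ x - φ (x - t • w)) := by
      simp only [mul_sub]
      rw [integral_sub (K.integrable.mul_const _) hint, integral_mul_const, hK,
        P.integral_fourier_low, one_mul, sub_apply, P.convolution_fourier_lowDilation]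
    rw [h1]
    have h2 := norm_integral_le_of_norm_le (μ := volume)
      (f := fun w => K w * (φ x - φ (x - t • w)))
      (g := fun w => ‖K w‖ * (1 + ‖w‖) ^ (d + 2) *
        (t * (2 ^ (d + 1) * 8 ^ (d + 1)) * q * ((1 + ‖x‖) ^ (d + 1))⁻¹))
      ((K.integrable_norm_mul_one_add_norm_pow (d + 2)).mul_const _) (ae_of_all _ fun w => ?_)
    · rw [integral_mul_const, ← hJ] at h2
      refine h2.trans (le_of_eq (by ring))
    · rw [norm_mul, mul_assoc]
      refine mul_le_mul_of_nonneg_left ((φ.norm_sub_comp_sub_le (d + 1) x (t • w)).trans ?_)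
        (norm_nonneg _)
      rw [← hq, norm_smul, Real.norm_of_nonneg ht.le]
      -- The restriction `t ≤ 8` keeps this constant uniform. The increment itself supplies the gain
      -- `t` and one more weight `1 + ‖w‖`, hence the exponent `d + 2` in `J`.
      have h3 : 1 + t * ‖w‖ ≤ 8 * (1 + ‖w‖) := by nlinarith [norm_nonneg w]
      have h4 := pow_le_pow_left₀ (by positivity) h3 (d + 1)
      rw [mul_pow] at h4
      have h5 : (1 + t * ‖w‖) ^ (d + 1) * (t * ‖w‖) ≤
          8 ^ (d + 1) * (1 + ‖w‖) ^ (d + 1) * (t * (1 + ‖w‖)) := by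
        refine mul_le_mul h4 ?_ (by positivity) (by positivity)
        exact mul_le_mul_of_nonneg_left (by linarith) ht.le
      refine (mul_le_mul_of_nonneg_left h5 (by positivity)).trans (le_of_eq ?_)
      ring
  calc _ ≤ ∫ x, t * (2 ^ (d + 1) * 8 ^ (d + 1) * J) * q *
        ((1 + ‖x‖ : ℝ) ^ (d + 1))⁻¹ :=
        integral_mono (SchwartzMap.integrable _).norm
          ((integrable_inv_one_add_norm_pow d).const_mul _) hpt
    _ = _ := by
      rw [integral_const_mul]
      ring

end DyadicPartition

/-! ### Convergence of series of tempered distributions -/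

/-- A series of tempered distributions converges if it is dominated by a geometric series, locally
uniformly for one of the Schwartz seminorms. -/
theorem summable_of_norm_apply_le_seminorm {d : ℕ}
    {U : ℕ → 𝓢'(EuclideanSpace ℝ (Fin d), ℂ)} {D : ℝ} (hD : 0 ≤ D) (s : Finset (ℕ × ℕ))
    (hU : ∀ j φ, ‖U j φ‖ ≤ D * (1 / 2) ^ j *
      (s.sup (schwartzSeminormFamily ℂ (EuclideanSpace ℝ (Fin d)) ℂ)) φ) : Summable U := by
  have hg : Summable fun j : ℕ => D * (1 / 2 : ℝ) ^ j := summable_geometric_two.mul_left D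
  have hs : ∀ φ, Summable fun j => U j φ := fun φ =>
    Summable.of_norm_bounded (hg.mul_right _) fun j => hU j φ
  -- One finite family of seminorms dominates all terms, so the pointwise sum is continuous.
  -- Convergence in `𝓢'` is then pointwise convergence.
  let A : 𝓢(EuclideanSpace ℝ (Fin d), ℂ) →L[ℂ] ℂ :=
    SchwartzMap.mkCLMtoNormedSpace (σ := RingHom.id ℂ) (fun φ => ∑' j, U j φ)
      (fun φ ψ => by simp only [map_add]; exact (hs φ).tsum_add (hs ψ))
      (fun a φ => by simp only [map_smul]; exact (hs φ).tsum_const_smul a)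
      ⟨s, D * 2, by positivity, fun φ => by
        exact tsum_of_norm_bounded ((hasSum_geometric_two.mul_left D).mul_right _)
          fun j => hU j φ⟩
  refine ⟨ContinuousLinearMap.toPointwiseConvergenceCLM ℂ (RingHom.id ℂ) _ _ A, ?_⟩
  refine PointwiseConvergenceCLM.tendsto_iff_forall_tendsto.2 fun φ => ?_
  have h := (hs φ).hasSum
  refine Filter.Tendsto.congr (fun t => ?_) h
  exact (map_sum (PointwiseConvergenceCLM.evalCLM (RingHom.id ℂ) ℂ φ) U t).symm

/-! ### The paraproduct with a bounded function -/

namespace DyadicPartition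

variable {d : ℕ} (P : DyadicPartition d) {f f' h h' : 𝓢'(EuclideanSpace ℝ (Fin d), ℂ)} {C C' : ℝ}

/-- The space of the distributions with uniformly bounded Littlewood-Paley blocks. It is the
Besov space `B⁰_{∞,∞}`. -/
def boundedBlocks : Submodule ℝ 𝓢'(EuclideanSpace ℝ (Fin d), ℂ) where
  carrier := {h | ∃ C, ∀ n, IsBoundedFunction (P.block n h) C}
  zero_mem' := ⟨0, fun n => by rw [map_zero]; exact IsBoundedFunction.zero⟩
  add_mem' := by
    rintro h h' ⟨C, hC⟩ ⟨C', hC'⟩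
    exact ⟨C + C', fun n => by rw [map_add]; exact (hC n).add (hC' n)⟩
  smul_mem' := by
    rintro c h ⟨C, hC⟩
    refine ⟨‖(c : ℂ)‖ * C, fun n => ?_⟩
    have : P.block n (c • h) = (c : ℂ) • P.block n h := (P.block n).map_smul (c : ℂ) h
    rw [this]
    exact (hC n).smul _

theorem isBoundedFunction_mem_boundedBlocks (hh : IsBoundedFunction h C) :
    h ∈ P.boundedBlocks := by
  obtain ⟨L, hL⟩ := P.exists_integral_norm_fourier_symbol_le
  exact ⟨L * C, fun n => (hh.fourierMultiplier (P.symbolSchwartz n)).mono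
    (mul_le_mul_of_nonneg_right (hL n) hh.nonneg)⟩

/-- The paraproduct of a bounded function with a distribution with bounded blocks converges. -/
theorem paraConverges (hf : IsBoundedFunction f C) (hh : h ∈ P.boundedBlocks) :
    P.ParaConverges f h := by
  obtain ⟨C', hh⟩ := hh
  obtain ⟨M, hM0, hM⟩ := P.exists_integral_norm_sub_convolution_le
  set D := (∫ z, ‖𝓕 (P.symbolSchwartz 0) z‖) * C * C' with hD
  have hu : ∀ j, IsBoundedFunction (P.paraTerm f h j) D := fun j =>
    P.isBoundedFunction_paraTerm hf (hh (j + 1))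
  have hD0 : 0 ≤ D := (hu 0).nonneg
  -- `16 = 8 · 2`: the factor `8` is that of the filter scale `8 · 2^{-k}` below, and `2` comes from
  -- writing `2^{-k}` as `2 · 2^{-j}` with `j = k + 1`.
  refine summable_of_norm_apply_le_seminorm (D := 16 * D * M) (by positivity)
    (Finset.Iic (d + 1, 1)) fun j φ => ?_
  cases j with
  | zero =>
    rw [paraTerm_zero, zero_apply, norm_zero]
    exact mul_nonneg (by positivity) (apply_nonneg _ _)
  | succ k =>
    -- At this scale the filter passes only `2^{-k} ‖η‖ < (4/3)/8 = 1/6`, the hole of the annulus.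
    -- The term therefore sees only the high-frequency part of `φ`, which is `O(2^{-k})` in `L¹`.
    have ht : (0 : ℝ) < 8 * 2⁻¹ ^ k := by positivity
    have h1 : P.paraTerm f h (k + 1) (SchwartzMap.convolution (ContinuousLinearMap.mul ℂ ℂ)
        (𝓕 (P.lowDilation ht)) φ) = 0 := by
      rw [← SchwartzMap.fourier_smulLeft_fourierInv]
      refine P.paraTerm_multiplier_eq_zero hf k _ _ fun η h2 _ => ?_
      by_contra h3
      rw [lowDilation_apply] at h3
      have h4 := P.norm_lt_of_low_ne_zero (fun h0 => h3 (by rw [h0]; rfl))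
      rw [norm_smul, Real.norm_of_nonneg ht.le] at h4
      linarith
    have h5 := (hu (k + 1)).norm_apply_le (φ - SchwartzMap.convolution
      (ContinuousLinearMap.mul ℂ ℂ) (𝓕 (P.lowDilation ht)) φ)
    rw [map_sub, h1, sub_zero] at h5
    have h6 := hM _ ht (by
      have : (2 : ℝ)⁻¹ ^ k ≤ 1 := pow_le_one₀ (by norm_num) (by norm_num)
      linarith) φ
    refine h5.trans ((mul_le_mul_of_nonneg_left h6 hD0).trans (le_of_eq ?_))
    rw [pow_succ, one_div]
    ring

/-- The paraproduct with a bounded function preserves the boundedness of the blocks. -/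
theorem para_mem_boundedBlocks (hf : IsBoundedFunction f C) (hh : h ∈ P.boundedBlocks) :
    P.para f h ∈ P.boundedBlocks := by
  have hsum := P.paraConverges hf hh
  obtain ⟨C', hh⟩ := hh
  obtain ⟨L, hL⟩ := P.exists_integral_norm_fourier_symbol_le
  set D := (∫ z, ‖𝓕 (P.symbolSchwartz 0) z‖) * C * C' with hD
  have hu : ∀ j, IsBoundedFunction (P.paraTerm f h j) D := fun j =>
    P.isBoundedFunction_paraTerm hf (hh (j + 1))
  have hb : ∀ n j, IsBoundedFunction (P.block n (P.paraTerm f h j)) (L * D) := fun n j =>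
    ((hu j).fourierMultiplier (P.symbolSchwartz n)).mono
      (mul_le_mul_of_nonneg_right (hL n) (hu j).nonneg)
  refine ⟨7 * (L * D), fun n => ?_⟩
  -- With `j = k + 1`, the vanishing conditions `n + 3 ≤ k` and `k + 5 ≤ n` say exactly that `j`
  -- lies outside this window. It has at most `7` indices, fewer when `n - 3` is truncated.
  have h1 : P.block n (P.para f h) = ∑ j ∈ Finset.Icc (n - 3) (n + 3),
      P.block n (P.paraTerm f h j) := by
    rw [para, (P.block n).map_tsum hsum]
    refine tsum_eq_sum fun j hj => ?_
    rw [Finset.mem_Icc, not_and_or] at hj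
    cases j with
    | zero => rw [paraTerm_zero, map_zero]
    | succ k => exact P.block_paraTerm_eq_zero hf (by omega)
  rw [h1]
  refine (IsBoundedFunction.sum _ fun j _ => hb n j).mono
    (mul_le_mul_of_nonneg_right ?_ (hb 0 0).nonneg)
  rw [Nat.card_Icc]
  exact_mod_cast (by omega : n + 3 + 1 - (n - 3) ≤ 7)

/-! ### Bilinearity of the paraproduct -/

theorem paraTerm_add_left (hf : IsBoundedFunction f C) (hf' : IsBoundedFunction f' C') (j : ℕ) :
    P.paraTerm (f + f') h j = P.paraTerm f h j + P.paraTerm f' h j := by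
  have h1 : (fun x => ∑ n ∈ Finset.range j, P.blockFun n (f + f') x) =
      (fun x => ∑ n ∈ Finset.range j, P.blockFun n f x) +
        fun x => ∑ n ∈ Finset.range j, P.blockFun n f' x := by
    ext x
    rw [Pi.add_apply, ← Finset.sum_add_distrib]
    rfl
  rw [paraTerm, h1, TemperedDistribution.smulLeftCLM_add
    (P.hasTemperateGrowth_sum_blockFun hf j) (P.hasTemperateGrowth_sum_blockFun hf' j)]
  rfl

theorem paraTerm_smul_left (hf : IsBoundedFunction f C) (c : ℝ) (j : ℕ) :
    P.paraTerm (c • f) h j = c • P.paraTerm f h j := by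
  have h1 : (fun x => ∑ n ∈ Finset.range j, P.blockFun n (c • f) x) =
      (c : ℂ) • (fun x => ∑ n ∈ Finset.range j, P.blockFun n f x) := by
    ext x
    rw [Pi.smul_apply, Finset.smul_sum]
    rfl
  rw [paraTerm, h1, TemperedDistribution.smulLeftCLM_smul
    (P.hasTemperateGrowth_sum_blockFun hf j)]
  rfl

theorem paraTerm_add_right (j : ℕ) :
    P.paraTerm f (h + h') j = P.paraTerm f h j + P.paraTerm f h' j := by
  simp only [paraTerm, map_add]

theorem paraTerm_smul_right (c : ℝ) (j : ℕ) :
    P.paraTerm f (c • h) j = c • P.paraTerm f h j := by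
  have h1 : P.block (j + 1) (c • h) = (c : ℂ) • P.block (j + 1) h :=
    (P.block (j + 1)).map_smul (c : ℂ) h
  rw [paraTerm, h1, map_smul]
  rfl

/-- Linearity of the terms passes to the sums because all the series converge; a divergent `tsum`
would only be a default value. -/
theorem para_add_left (hf : IsBoundedFunction f C) (hf' : IsBoundedFunction f' C')
    (hh : h ∈ P.boundedBlocks) : P.para (f + f') h = P.para f h + P.para f' h := by
  rw [para, para, para, ← (P.paraConverges hf hh).tsum_add (P.paraConverges hf' hh)]
  exact tsum_congr fun j => P.paraTerm_add_left hf hf' j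

theorem para_smul_left (hf : IsBoundedFunction f C) (c : ℝ) (hh : h ∈ P.boundedBlocks) :
    P.para (c • f) h = c • P.para f h := by
  rw [para, para, ← (P.paraConverges hf hh).tsum_const_smul c]
  exact tsum_congr fun j => P.paraTerm_smul_left hf c j

theorem para_add_right (hf : IsBoundedFunction f C) (hh : h ∈ P.boundedBlocks)
    (hh' : h' ∈ P.boundedBlocks) : P.para f (h + h') = P.para f h + P.para f h' := by
  rw [para, para, para, ← (P.paraConverges hf hh).tsum_add (P.paraConverges hf hh')]
  exact tsum_congr fun j => P.paraTerm_add_right j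

theorem para_smul_right (hf : IsBoundedFunction f C) (c : ℝ) (hh : h ∈ P.boundedBlocks) :
    P.para f (c • h) = c • P.para f h := by
  rw [para, para, ← (P.paraConverges hf hh).tsum_const_smul c]
  exact tsum_congr fun j => P.paraTerm_smul_right c j

end DyadicPartition

/-! ### Bounded continuous functions as distributions -/

theorem memLp_top_ofReal {d : ℕ} {f : EuclideanSpace ℝ (Fin d) → ℝ} (hf : Continuous f) {C : ℝ}
    (hC : ∀ x, |f x| ≤ C) : MemLp (fun x => (f x : ℂ)) ⊤ volume :=
  memLp_top_of_bound (Complex.continuous_ofReal.comp hf).aestronglyMeasurable C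
    (ae_of_all _ fun x => by simpa using hC x)

/-- Continuity provides measurability, so the default value `0` in `funDistribution` is not taken.
-/
theorem funDistribution_apply {d : ℕ} {f : EuclideanSpace ℝ (Fin d) → ℝ} (hf : Continuous f)
    {C : ℝ} (hC : ∀ x, |f x| ≤ C) (φ : 𝓢(EuclideanSpace ℝ (Fin d), ℂ)) :
    funDistribution f φ = ∫ x, φ x * (f x : ℂ) := by
  rw [funDistribution, dif_pos (memLp_top_ofReal hf hC), Lp.toTemperedDistribution_apply]
  refine integral_congr_ae ?_
  filter_upwards [(memLp_top_ofReal hf hC).coeFn_toLp] with x hx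
  rw [hx, smul_eq_mul]

theorem isBoundedFunction_funDistribution {d : ℕ} {f : EuclideanSpace ℝ (Fin d) → ℝ}
    (hf : Continuous f) {C : ℝ} (hC : ∀ x, |f x| ≤ C) :
    IsBoundedFunction (funDistribution f) C :=
  ⟨fun x => (f x : ℂ), (Complex.continuous_ofReal.comp hf).aestronglyMeasurable,
    fun x => by simpa using hC x, funDistribution_apply hf hC⟩

theorem funDistribution_add {d : ℕ} {f f' : EuclideanSpace ℝ (Fin d) → ℝ} (hf : Continuous f)
    (hf' : Continuous f') {C C' : ℝ} (hC : ∀ x, |f x| ≤ C) (hC' : ∀ x, |f' x| ≤ C') :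
    funDistribution (fun x => f x + f' x) = funDistribution f + funDistribution f' := by
  ext φ
  rw [funDistribution_apply (f := fun x => f x + f' x) (hf.add hf') (C := C + C')
    (fun x => (abs_add_le _ _).trans (add_le_add (hC x) (hC' x))), add_apply,
    funDistribution_apply hf hC, funDistribution_apply hf' hC', ← integral_add]
  · simp only [Complex.ofReal_add, mul_add]
  · exact IsBoundedFunction.integrable_mul (u := fun x => (f x : ℂ))
      (Complex.continuous_ofReal.comp hf).aestronglyMeasurable (fun x => by simpa using hC x) φ
  · exact IsBoundedFunction.integrable_mul (u := fun x => (f' x : ℂ))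
      (Complex.continuous_ofReal.comp hf').aestronglyMeasurable (fun x => by simpa using hC' x) φ

theorem funDistribution_smul {d : ℕ} {f : EuclideanSpace ℝ (Fin d) → ℝ} (hf : Continuous f)
    {C : ℝ} (hC : ∀ x, |f x| ≤ C) (c : ℝ) :
    funDistribution (fun x => c * f x) = c • funDistribution f := by
  ext φ
  have h1 : (c • funDistribution f) φ = (c : ℂ) * funDistribution f φ := rfl
  rw [h1, funDistribution_apply hf hC,
    funDistribution_apply (f := fun x => c * f x) (continuous_const.mul hf)
    (C := |c| * C) (fun x => by
      rw [abs_mul]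
      exact mul_le_mul_of_nonneg_left (hC x) (abs_nonneg c)), ← integral_const_mul]
  refine integral_congr_ae (ae_of_all _ fun x => ?_)
  simp only [Complex.ofReal_mul]
  ring

/-! ### Coproducts in homogeneous bases -/

/-- Reads off one coefficient of a graded remainder. Taking `Q = ⊥` shows that it vanishes; a
homogeneous subspace as `Q` determines its degree. -/
theorem TensorProduct.equivFinsuppOfBasisLeft_mem_of_mem_iSup {M N κ : Type*}
    [AddCommGroup M] [Module ℝ M] [AddCommGroup N] [Module ℝ N] [DecidableEq κ]
    (b : Module.Basis κ ℝ M)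
    {I : Set ℝ} {V : ℝ → Submodule ℝ M} {W : ℝ → Submodule ℝ N} {k : κ} {Q : Submodule ℝ N}
    (hV : ∀ β ∈ I, ∀ a ∈ V β, b.repr a k = 0 ∨ W β ≤ Q) {z : M ⊗[ℝ] N}
    (hz : z ∈ ⨆ β ∈ I, tensorSubmodule (V β) (W β)) :
    TensorProduct.equivFinsuppOfBasisLeft b z k ∈ Q := by
  have hle : (⨆ β ∈ I, tensorSubmodule (V β) (W β)) ≤
      Q.comap (Finsupp.lapply (R := ℝ) k ∘ₗ
        (TensorProduct.equivFinsuppOfBasisLeft (N := N) b).toLinearMap) := by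
    refine iSup₂_le fun β hβ => ?_
    rintro _ ⟨w, rfl⟩
    induction w using TensorProduct.induction_on with
    | zero => simp
    | add x y hx hy => rw [map_add]; exact Submodule.add_mem _ hx hy
    | tmul x y =>
      rcases hV β hβ x x.2 with h | h
      · simp [h]
      · simpa using Q.smul_mem _ (h y.2)
  exact hle hz

namespace HomogeneousBases

variable {Tp T : Type*} [Ring Tp] [HopfAlgebra ℝ Tp] [AddCommGroup T] [Module ℝ T]
  {S : ConcreteRegularityStructure Tp T} {ιp ι : Type*} (B : HomogeneousBases S ιp ι)

theorem comul_basisP (τ : ιp) :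
    Coalgebra.comul (R := ℝ) (B.basisP τ) =
      ∑ σ ∈ (B.quotP τ).support, B.basisP σ ⊗ₜ[ℝ] B.quotP τ σ := by
  classical
  have h := (TensorProduct.equivFinsuppOfBasisLeft (N := Tp) B.basisP).symm_apply_apply
    (Coalgebra.comul (R := ℝ) (B.basisP τ))
  rw [TensorProduct.equivFinsuppOfBasisLeft_symm_apply] at h
  rw [← h]
  simp only [quotP, Finsupp.sum]

theorem split_basis (τ : ι) :
    S.split (B.basis τ) = ∑ σ ∈ (B.quot τ).support, B.basis σ ⊗ₜ[ℝ] B.quot τ σ := by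
  classical
  have h := (TensorProduct.equivFinsuppOfBasisLeft (N := Tp) B.basis).symm_apply_apply
    (S.split (B.basis τ))
  rw [TensorProduct.equivFinsuppOfBasisLeft_symm_apply] at h
  rw [← h]
  simp only [quot, Finsupp.sum]

/-- The coordinates of a homogeneous element vanish along basis elements of other degrees. -/
theorem basis_coord_eq_zero {α : ℝ} {x : T} (hx : x ∈ S.grade α) {i : ι} (hi : B.deg i ≠ α) :
    B.basis.repr x i = 0 := by
  classical
  set r := (B.basis.repr x).filter (fun j => B.deg j ≠ α) with hr
  set s := (B.basis.repr x).filter (fun j => ¬ B.deg j ≠ α) with hs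
  have hsum : r + s = B.basis.repr x := Finsupp.filter_add_filter_not _ _
  have h1 : B.basis.repr.symm s ∈ S.grade α := by
    rw [Module.Basis.repr_symm_apply, Finsupp.linearCombination_apply]
    refine Submodule.sum_mem _ fun j hj => Submodule.smul_mem _ _ ?_
    have : B.deg j = α := by
      by_contra h
      exact (Finsupp.mem_support_iff.1 hj) (Finsupp.filter_apply_neg _ _ (by simpa using h))
    exact this ▸ B.basis_mem j
  have h2 : B.basis.repr.symm r ∈ ⨆ β, ⨆ (_ : β ≠ α), S.grade β := by
    rw [Module.Basis.repr_symm_apply, Finsupp.linearCombination_apply]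
    refine Submodule.sum_mem _ fun j hj => Submodule.smul_mem _ _ ?_
    have : B.deg j ≠ α := by
      by_contra h
      exact (Finsupp.mem_support_iff.1 hj) (Finsupp.filter_apply_neg _ _ (by simpa using h))
    exact Submodule.mem_iSup_of_mem _ (Submodule.mem_iSup_of_mem this (B.basis_mem j))
  have h3 : B.basis.repr.symm r ∈ S.grade α := by
    have : B.basis.repr.symm r = x - B.basis.repr.symm s := by
      rw [eq_sub_iff_add_eq, ← map_add, hsum, LinearEquiv.symm_apply_apply]
    rw [this]
    exact Submodule.sub_mem _ hx h1
  have h4 : B.basis.repr.symm r = 0 :=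
    (Submodule.disjoint_def.1 (S.grade_internal.submodule_iSupIndep α)) _ h3 h2
  have h5 : r = 0 := (LinearEquiv.map_eq_zero_iff _).1 h4
  rw [← Finsupp.filter_apply_pos (fun j => B.deg j ≠ α) (B.basis.repr x) hi, ← hr, h5]
  rfl

theorem degP_nonneg (i : ιp) : 0 ≤ B.degP i :=
  S.Ap_nonneg _ (B.degP_mem i)

/-- The unit is the only basis element of degree zero. -/
theorem degP_pos {i : ιp} (hi : i ≠ B.one) : 0 < B.degP i := by
  refine (B.degP_nonneg i).lt_of_ne fun h0 => hi ?_
  have h := B.basisP_mem i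
  rw [← h0, S.gradeP_zero, ← B.basisP_one, Submodule.mem_span_singleton] at h
  obtain ⟨c, hc⟩ := h
  by_contra hne
  have h1 := congrArg (fun x => B.basisP.repr x i) hc
  simp [Finsupp.single_eq_of_ne hne] at h1

theorem degP_one : B.degP B.one = 0 := by
  by_contra h
  have h1 : B.basisP B.one ∈ S.gradeP 0 := by
    rw [B.basisP_one, S.gradeP_zero]
    exact Submodule.mem_span_singleton_self _
  have h2 := B.coord_eq_zero h1 h
  simp at h2

theorem ne_one_of_degP_pos {i : ιp} (hi : 0 < B.degP i) : i ≠ B.one := by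
  rintro rfl
  exact hi.ne' B.degP_one

/-- The left factors of the remainder of `Δ⁺ τ` have degrees strictly between `0` and `|τ|`, so only
the explicit terms contribute along `τ`, and likewise along the unit. -/
theorem quotP_self {τ : ιp} (hτ : 0 < B.degP τ) : B.quotP τ τ = 1 := by
  classical
  have hne := B.ne_one_of_degP_pos hτ
  have h := TensorProduct.equivFinsuppOfBasisLeft_mem_of_mem_iSup B.basisP (k := τ) (Q := ⊥)
    (fun β hβ a ha => Or.inl (B.coord_eq_zero ha hβ.2.ne')) (S.comul_mem _ hτ _ (B.basisP_mem τ))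
  rw [Submodule.mem_bot, map_sub, map_sub, Finsupp.sub_apply, Finsupp.sub_apply,
    TensorProduct.equivFinsuppOfBasisLeft_apply_tmul_apply,
    TensorProduct.equivFinsuppOfBasisLeft_apply_tmul_apply, ← B.basisP_one,
    Module.Basis.repr_self, Module.Basis.repr_self, Finsupp.single_eq_same,
    Finsupp.single_eq_of_ne hne, one_smul, zero_smul, sub_zero, sub_eq_zero, B.basisP_one] at h
  rw [quotP, ← h]

theorem quotP_one {τ : ιp} (hτ : 0 < B.degP τ) : B.quotP τ B.one = B.basisP τ := by
  classical
  have hne := B.ne_one_of_degP_pos hτ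
  have h := TensorProduct.equivFinsuppOfBasisLeft_mem_of_mem_iSup B.basisP (k := B.one)
    (Q := ⊥) (fun β hβ a ha => Or.inl (B.coord_eq_zero ha (by rw [B.degP_one]; exact hβ.1.ne)))
    (S.comul_mem _ hτ _ (B.basisP_mem τ))
  rw [Submodule.mem_bot, map_sub, map_sub, Finsupp.sub_apply, Finsupp.sub_apply,
    TensorProduct.equivFinsuppOfBasisLeft_apply_tmul_apply,
    TensorProduct.equivFinsuppOfBasisLeft_apply_tmul_apply, ← B.basisP_one,
    Module.Basis.repr_self, Module.Basis.repr_self, Finsupp.single_eq_same,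
    Finsupp.single_eq_of_ne hne.symm, one_smul, zero_smul, sub_zero, sub_eq_zero] at h
  rw [quotP, ← h]
  congr!

/-- Consequently the condition `1 <⁺ ν` in the recursion excludes nothing but `ν = 1`. -/
theorem ltP_one {τ : ιp} (hτ : τ ≠ B.one) : B.ltP B.one τ := by
  refine ⟨?_, hτ.symm⟩
  rw [B.quotP_one (B.degP_pos hτ)]
  exact B.basisP.ne_zero τ

/-- The reduced coproduct of a basis element of `T⁺`. -/
theorem reduced_comul_basisP {τ : ιp} (hτ : 0 < B.degP τ) :
    Coalgebra.comul (R := ℝ) (B.basisP τ) - B.basisP τ ⊗ₜ[ℝ] (1 : Tp) -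
      (1 : Tp) ⊗ₜ[ℝ] B.basisP τ =
      ∑ ν ∈ B.betweenP B.one τ, B.basisP ν ⊗ₜ[ℝ] B.quotP τ ν := by
  classical
  have hne := B.ne_one_of_degP_pos hτ
  have h1 : (B.quotP τ).support = insert τ (insert B.one (B.betweenP B.one τ)) := by
    ext ν
    simp only [Finset.mem_insert, mem_betweenP, Finsupp.mem_support_iff]
    constructor
    · intro h
      by_cases h2 : ν = τ
      · exact Or.inl h2
      by_cases h3 : ν = B.one
      · exact Or.inr (Or.inl h3)
      exact Or.inr (Or.inr ⟨B.ltP_one h3, h, h2⟩)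
    · rintro (rfl | rfl | h)
      · rw [B.quotP_self hτ, ← B.basisP_one]
        exact B.basisP.ne_zero _
      · rw [B.quotP_one hτ]
        exact B.basisP.ne_zero _
      · exact h.2.1
  rw [B.comul_basisP, h1, Finset.sum_insert, Finset.sum_insert, B.quotP_self hτ, B.quotP_one hτ,
    B.basisP_one]
  · abel
  · rw [mem_betweenP]
    exact fun h => h.1.2 rfl
  · rw [Finset.mem_insert, mem_betweenP]
    rintro (h | h)
    · exact hne h
    · exact h.2.2 rfl

theorem quot_self (τ : ι) : B.quot τ τ = 1 := by
  classical
  have h := TensorProduct.equivFinsuppOfBasisLeft_mem_of_mem_iSup B.basis (k := τ) (Q := ⊥)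
    (fun β hβ a ha => Or.inl (B.basis_coord_eq_zero ha (Set.mem_Iio.1 hβ).ne'))
    (S.split_mem _ _ (B.basis_mem τ))
  rw [Submodule.mem_bot, map_sub, Finsupp.sub_apply,
    TensorProduct.equivFinsuppOfBasisLeft_apply_tmul_apply,
    Module.Basis.repr_self, Finsupp.single_eq_same, one_smul, sub_eq_zero] at h
  rw [quot, ← h]

/-- Only the component with left degree `β = |σ|` has a coefficient along `σ`, and its right factor
has degree `|τ| - β`. -/
theorem quot_mem_gradeP {σ τ : ι} (h : σ ≠ τ) : B.quot τ σ ∈ S.gradeP (B.deg τ - B.deg σ) := by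
  classical
  have h1 := TensorProduct.equivFinsuppOfBasisLeft_mem_of_mem_iSup B.basis (k := σ)
    (Q := S.gradeP (B.deg τ - B.deg σ))
    (fun β hβ a ha => by
      by_cases hσ : B.deg σ = β
      · exact Or.inr (by rw [hσ])
      · exact Or.inl (B.basis_coord_eq_zero ha hσ))
    (S.split_mem _ _ (B.basis_mem τ))
  rw [map_sub, Finsupp.sub_apply, TensorProduct.equivFinsuppOfBasisLeft_apply_tmul_apply,
    Module.Basis.repr_self, Finsupp.single_eq_of_ne h, zero_smul, sub_zero] at h1
  rw [quot]
  convert h1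

theorem deg_lt {σ τ : ι} (h : B.lt σ τ) : B.deg σ < B.deg τ := by
  classical
  by_contra hlt
  apply h.1
  have h1 := TensorProduct.equivFinsuppOfBasisLeft_mem_of_mem_iSup B.basis (k := σ) (Q := ⊥)
    (fun β hβ a ha => Or.inl (B.basis_coord_eq_zero ha
      (fun e => hlt (e ▸ Set.mem_Iio.1 hβ)))) (S.split_mem _ _ (B.basis_mem τ))
  rw [Submodule.mem_bot, map_sub, Finsupp.sub_apply,
    TensorProduct.equivFinsuppOfBasisLeft_apply_tmul_apply, Module.Basis.repr_self,
    Finsupp.single_eq_of_ne h.2, zero_smul, sub_zero] at h1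
  rw [quot, ← h1]

/-- `Δ⁺(τ/σ) = ∑ (η/σ) ⊗ (τ/η)`. -/
theorem comul_quot (σ τ : ι) :
    Coalgebra.comul (R := ℝ) (B.quot τ σ) =
      ∑ η ∈ (B.quot τ).support, B.quot η σ ⊗ₜ[ℝ] B.quot τ η := by
  classical
  -- Take the coefficient of `σ` in the first factor of the comodule identity.
  have h := congrArg (fun F => TensorProduct.equivFinsuppOfBasisLeft (N := Tp ⊗[ℝ] Tp) B.basis
    (F (B.basis τ)) σ) S.split_comodule
  simp only [LinearMap.comp_apply, B.split_basis τ, map_sum, LinearMap.rTensor_tmul,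
    LinearMap.lTensor_tmul, LinearEquiv.coe_coe] at h
  simp only [Finsupp.coe_finsetSum, Finset.sum_apply] at h
  simp only [TensorProduct.equivFinsuppOfBasisLeft_apply_tmul_apply, Module.Basis.repr_self] at h
  have h1 : ∑ η ∈ (B.quot τ).support, (Finsupp.single η (1 : ℝ)) σ •
      Coalgebra.comul (R := ℝ) (B.quot τ η) = Coalgebra.comul (R := ℝ) (B.quot τ σ) := by
    by_cases hσ : B.quot τ σ = 0
    · rw [hσ, map_zero]
      refine Finset.sum_eq_zero fun η hη => ?_
      rw [Finsupp.single_eq_of_ne, zero_smul]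
      rintro rfl
      exact (Finsupp.mem_support_iff.1 hη) hσ
    · rw [Finset.sum_eq_single σ]
      · simp
      · intro η _ hη
        rw [Finsupp.single_eq_of_ne hη.symm, zero_smul]
      · intro h2
        exact absurd (Finsupp.mem_support_iff.2 hσ) h2
  rw [h1] at h
  rw [← h]
  refine Finset.sum_congr rfl fun η _ => ?_
  have h2 : ∀ (z : T ⊗[ℝ] Tp) (b : Tp),
      TensorProduct.equivFinsuppOfBasisLeft (N := Tp ⊗[ℝ] Tp) B.basis
        (TensorProduct.assoc ℝ T Tp Tp (z ⊗ₜ[ℝ] b)) σ =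
      TensorProduct.equivFinsuppOfBasisLeft (N := Tp) B.basis z σ ⊗ₜ[ℝ] b := by
    intro z b
    induction z using TensorProduct.induction_on with
    | zero => simp
    | add x y hx hy =>
      rw [TensorProduct.add_tmul, map_add, map_add, Finsupp.add_apply, hx, hy, map_add,
        Finsupp.add_apply, TensorProduct.add_tmul]
    | tmul x y => simp [TensorProduct.smul_tmul']
  rw [h2, quot]
  congr!

/-- The reduced coproduct of `τ/σ`. -/
theorem reduced_comul_quot {σ τ : ι} (h : B.lt σ τ) :
    Coalgebra.comul (R := ℝ) (B.quot τ σ) - B.quot τ σ ⊗ₜ[ℝ] (1 : Tp) -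
      (1 : Tp) ⊗ₜ[ℝ] B.quot τ σ =
      ∑ η ∈ B.between σ τ, B.quot η σ ⊗ₜ[ℝ] B.quot τ η := by
  classical
  -- Indices with `η/σ = 0` contribute nothing; `η = τ` and `η = σ` give the two primitive terms
  -- because `τ/τ = σ/σ = 1`.
  have h1 : ∑ η ∈ (B.quot τ).support, B.quot η σ ⊗ₜ[ℝ] B.quot τ η =
      ∑ η ∈ insert τ (insert σ (B.between σ τ)), B.quot η σ ⊗ₜ[ℝ] B.quot τ η := by
    symm
    refine Finset.sum_subset (fun η hη => ?_) fun η h2 h3 => ?_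
    · rw [Finset.mem_insert, Finset.mem_insert, mem_between] at hη
      rw [Finsupp.mem_support_iff]
      rcases hη with rfl | rfl | hη
      · rw [B.quot_self]
        intro h4
        apply B.basisP.ne_zero B.one
        rw [B.basisP_one, h4]
      · exact h.1
      · exact hη.2.1
    · rw [Finset.mem_insert, Finset.mem_insert, mem_between, not_or, not_or] at h3
      by_cases h4 : B.quot η σ = 0
      · rw [h4, TensorProduct.zero_tmul]
      · exact absurd ⟨⟨h4, fun e => h3.2.1 e.symm⟩, Finsupp.mem_support_iff.1 h2, h3.1⟩ h3.2.2
  rw [B.comul_quot, h1, Finset.sum_insert, Finset.sum_insert, B.quot_self, B.quot_self]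
  · abel
  · rw [mem_between]
    exact fun h => h.1.2 rfl
  · rw [Finset.mem_insert, mem_between]
    rintro (h2 | h2)
    · exact h.2 h2.symm
    · exact h2.2.2 rfl

end HomogeneousBases

/-! ### Continuity of the characters -/

/-- `g_y = g_{yx} * g_x`. -/
theorem charIncrement_convolution {X Tp : Type*} [Ring Tp] [HopfAlgebra ℝ Tp]
    (g : X → Tp →ₐ[ℝ] ℝ) (y x : X) (a : Tp) :
    g y a = LinearMap.mul' ℝ ℝ (TensorProduct.map (charIncrement g y x) (g x).toLinearMap
      (Coalgebra.comul (R := ℝ) a)) := by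
  have h1 : WithConv.toConv (charIncrement g y x) = WithConv.toConv (g y).toLinearMap *
      WithConv.toConv ((g x).toLinearMap ∘ₗ HopfAlgebra.antipode ℝ) := rfl
  -- The antipode is the convolution inverse of the identity, and composition with a character
  -- respects convolution.
  have h2 : WithConv.toConv ((g x).toLinearMap ∘ₗ HopfAlgebra.antipode ℝ) *
      WithConv.toConv (g x).toLinearMap = 1 := by
    have h3 := LinearMap.algHom_comp_convMul_distrib (g x)
      (WithConv.toConv (HopfAlgebra.antipode ℝ (A := Tp)))
      (WithConv.toConv (LinearMap.id : Tp →ₗ[ℝ] Tp))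
    rw [LinearMap.antipode_mul_id, LinearMap.algHom_comp_convOne] at h3
    exact congrArg WithConv.toConv h3.symm
  have h4 : WithConv.toConv (charIncrement g y x) * WithConv.toConv (g x).toLinearMap =
      WithConv.toConv (g y).toLinearMap := by
    rw [h1, mul_assoc, h2, mul_one]
  have h5 := congrArg (fun f : WithConv (Tp →ₗ[ℝ] ℝ) => f.ofConv a) h4
  exact h5.symm

theorem charIncrement_one {X Tp : Type*} [Ring Tp] [HopfAlgebra ℝ Tp]
    (g : X → Tp →ₐ[ℝ] ℝ) (y x : X) : charIncrement g y x 1 = 1 := by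
  simp [charIncrement, Algebra.TensorProduct.one_def]

section model

variable {d : ℕ} {Tp T : Type*} [Ring Tp] [HopfAlgebra ℝ Tp] [AddCommGroup T] [Module ℝ T]
  {S : ConcreteRegularityStructure Tp T} {ιp ι : Type*} {B : HomogeneousBases S ιp ι}
  {g : EuclideanSpace ℝ (Fin d) → Tp →ₐ[ℝ] ℝ}

namespace IsModelMap

/-- In positive degree the bound by `‖y - x‖ ^ |σ|` forces both the value at `y = x` and the limit
to be `0`; at the unit the increment is constant. -/
theorem continuousAt_charIncrement (hg : IsModelMap B g) (x : EuclideanSpace ℝ (Fin d))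
    (σ : ιp) : ContinuousAt (fun y => charIncrement g y x (B.basisP σ)) x := by
  by_cases hσ : σ = B.one
  · simp only [hσ, B.basisP_one, charIncrement_one]
    exact continuousAt_const
  · have hpos := B.degP_pos hσ
    obtain ⟨C, -, hC⟩ := hg σ
    have h0 : charIncrement g x x (B.basisP σ) = 0 := by
      have := hC x x
      rw [sub_self, norm_zero, Real.zero_rpow hpos.ne', mul_zero] at this
      exact abs_nonpos_iff.1 this
    have h1 : Filter.Tendsto (fun y => C * ‖y - x‖ ^ B.degP σ) (nhds x) (nhds 0) := by
      have h2 : ContinuousAt (fun y => C * ‖y - x‖ ^ B.degP σ) x :=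
        continuousAt_const.mul ((by fun_prop : ContinuousAt (fun y => ‖y - x‖) x).rpow_const
          (Or.inr hpos.le))
      have h3 := h2.tendsto
      rwa [sub_self, norm_zero, Real.zero_rpow hpos.ne', mul_zero] at h3
    rw [ContinuousAt, h0]
    exact squeeze_zero_norm (fun y => hC x y) h1

/-- By `g_y = g_{yx} * g_x`, for fixed `x` the function of `y` is a finite combination of
increments. -/
theorem continuous_basisP (hg : IsModelMap B g) (τ : ιp) :
    Continuous fun x => g x (B.basisP τ) := by
  refine continuous_iff_continuousAt.2 fun x => ?_
  have h : (fun y => g y (B.basisP τ)) = fun y => ∑ σ ∈ (B.quotP τ).support,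
      charIncrement g y x (B.basisP σ) * g x (B.quotP τ σ) := by
    ext y
    rw [charIncrement_convolution g y x, B.comul_basisP]
    simp
  rw [h]
  exact tendsto_finsetSum _ fun σ _ => (hg.continuousAt_charIncrement x σ).mul_const _

theorem continuous_and_bounded (hg : IsModelMap B g) (a : Tp) :
    Continuous (fun x => g x a) ∧ ∃ C, ∀ x, |g x a| ≤ C := by
  have ha : a ∈ Submodule.span ℝ (Set.range B.basisP) := B.basisP.mem_span a
  induction ha using Submodule.span_induction with
  | mem a ha =>
    obtain ⟨τ, rfl⟩ := ha
    obtain ⟨C, hC, -⟩ := hg τ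
    exact ⟨hg.continuous_basisP τ, C, hC⟩
  | zero => exact ⟨by simpa using continuous_const, 0, by simp⟩
  | add a b _ _ ha hb =>
    obtain ⟨h1, C, h2⟩ := ha
    obtain ⟨h3, C', h4⟩ := hb
    refine ⟨by simp only [map_add]; exact h1.add h3, C + C', fun x => ?_⟩
    rw [map_add]
    exact (abs_add_le _ _).trans (add_le_add (h2 x) (h4 x))
  | smul c a _ ha =>
    obtain ⟨h1, C, h2⟩ := ha
    refine ⟨by simp only [map_smul]; exact h1.const_smul c, |c| * C, fun x => ?_⟩
    rw [map_smul, smul_eq_mul, abs_mul]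
    exact mul_le_mul_of_nonneg_left (h2 x) (abs_nonneg c)

theorem isBoundedFunction (hg : IsModelMap B g) (a : Tp) :
    ∃ C, IsBoundedFunction (funDistribution fun x => g x a) C := by
  obtain ⟨h1, C, h2⟩ := hg.continuous_and_bounded a
  exact ⟨C, isBoundedFunction_funDistribution h1 h2⟩

/-! ### Brackets as a linear map and their defining relation -/

/-- The map `a ↦ g(a)` with values in the tempered distributions. -/
def toDistribution (hg : IsModelMap B g) : Tp →ₗ[ℝ] 𝓢'(EuclideanSpace ℝ (Fin d), ℂ) where
  toFun a := funDistribution fun x => g x a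
  map_add' a b := by
    obtain ⟨h1, C, h2⟩ := hg.continuous_and_bounded a
    obtain ⟨h3, C', h4⟩ := hg.continuous_and_bounded b
    simpa only [map_add] using funDistribution_add h1 h3 h2 h4
  map_smul' c a := by
    obtain ⟨h1, C, h2⟩ := hg.continuous_and_bounded a
    simpa only [map_smul, smul_eq_mul, RingHom.id_apply] using funDistribution_smul h1 h2 c

theorem toDistribution_apply (hg : IsModelMap B g) (a : Tp) :
    hg.toDistribution a = funDistribution fun x => g x a :=
  rfl

/-- `B⁰_{∞,∞}` contains the bounded functions and is stable under paraproducts with them, so the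
recursion never leaves it. -/
theorem bracketBasis_mem_boundedBlocks (hg : IsModelMap B g) (P : DyadicPartition d) (τ : ιp) :
    bracketBasis B P g τ ∈ P.boundedBlocks := by
  induction hn : B.rankP τ using Nat.strong_induction_on generalizing τ with
  | _ n ih =>
    have h := bracketBasis_spec B P g τ
    rw [eq_sub_iff_add_eq'.2 h.symm]
    refine Submodule.sub_mem _ ?_ (Submodule.sum_mem _ fun ν hν => ?_)
    · obtain ⟨C, hC⟩ := hg.isBoundedFunction (B.basisP τ)
      exact P.isBoundedFunction_mem_boundedBlocks hC
    · obtain ⟨C, hC⟩ := hg.isBoundedFunction (B.quotP τ ν)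
      exact P.para_mem_boundedBlocks hC (ih _ (hn ▸ B.rankP_lt hν) ν rfl)

theorem bracket_mem_boundedBlocks (hg : IsModelMap B g) (P : DyadicPartition d) (a : Tp) :
    bracket B P g a ∈ P.boundedBlocks := by
  rw [bracket, Module.Basis.constr_apply]
  exact Submodule.sum_mem _ fun τ _ =>
    Submodule.smul_mem _ _ (hg.bracketBasis_mem_boundedBlocks P τ)

/-- The linear map `a ⊗ b ↦ P_{g(b)} ⟦a⟧^g`. -/
def paraTensor (hg : IsModelMap B g) (P : DyadicPartition d) :
    Tp ⊗[ℝ] Tp →ₗ[ℝ] 𝓢'(EuclideanSpace ℝ (Fin d), ℂ) :=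
  TensorProduct.lift <| LinearMap.mk₂ ℝ
    (fun a b => P.para (hg.toDistribution b) (bracket B P g a))
    (fun a a' b => by
      obtain ⟨C, hC⟩ := hg.isBoundedFunction b
      rw [map_add]
      exact P.para_add_right hC (hg.bracket_mem_boundedBlocks P a)
        (hg.bracket_mem_boundedBlocks P a'))
    (fun c a b => by
      obtain ⟨C, hC⟩ := hg.isBoundedFunction b
      rw [map_smul]
      exact P.para_smul_right hC c (hg.bracket_mem_boundedBlocks P a))
    (fun a b b' => by
      obtain ⟨C, hC⟩ := hg.isBoundedFunction b
      obtain ⟨C', hC'⟩ := hg.isBoundedFunction b'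
      rw [map_add]
      exact P.para_add_left hC hC' (hg.bracket_mem_boundedBlocks P a))
    (fun c a b => by
      obtain ⟨C, hC⟩ := hg.isBoundedFunction b
      rw [map_smul]
      exact P.para_smul_left hC c (hg.bracket_mem_boundedBlocks P a))

theorem paraTensor_tmul (hg : IsModelMap B g) (P : DyadicPartition d) (a b : Tp) :
    hg.paraTensor P (a ⊗ₜ[ℝ] b) =
      P.para (funDistribution fun x => g x b) (bracket B P g a) :=
  rfl

/-- The defining relation of the brackets, in terms of the reduced coproduct. -/
theorem toDistribution_eq (hg : IsModelMap B g) (P : DyadicPartition d) {α : ℝ} (hα : 0 < α)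
    {t : Tp} (ht : t ∈ S.gradeP α) :
    hg.toDistribution t = hg.paraTensor P (Coalgebra.comul (R := ℝ) t - t ⊗ₜ[ℝ] (1 : Tp) -
      (1 : Tp) ⊗ₜ[ℝ] t) + bracket B P g t := by
  have hbasis : ∀ τ : ιp, 0 < B.degP τ → hg.toDistribution (B.basisP τ) =
      hg.paraTensor P (Coalgebra.comul (R := ℝ) (B.basisP τ) - B.basisP τ ⊗ₜ[ℝ] (1 : Tp) -
        (1 : Tp) ⊗ₜ[ℝ] B.basisP τ) + bracket B P g (B.basisP τ) := by
    intro τ hτ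
    have hb : ∀ ν, bracket B P g (B.basisP ν) = bracketBasis B P g ν := fun ν =>
      B.basisP.constr_basis ℝ _ ν
    rw [B.reduced_comul_basisP hτ, map_sum, toDistribution_apply, bracketBasis_spec B P g τ, hb]
    simp only [paraTensor_tmul, hb]
  -- The right-hand side as one linear map. A homogeneous `t` of degree `α` expands in basis
  -- elements of degree `α > 0`, to which `hbasis` applies.
  let Φ : Tp →ₗ[ℝ] 𝓢'(EuclideanSpace ℝ (Fin d), ℂ) :=
    hg.paraTensor P ∘ₗ (Coalgebra.comul - (TensorProduct.mk ℝ Tp Tp).flip 1 -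
      TensorProduct.mk ℝ Tp Tp 1) + bracket B P g
  change hg.toDistribution t = Φ t
  rw [← B.basisP.linearCombination_repr t, Finsupp.linearCombination_apply, map_finsuppSum,
    map_finsuppSum]
  refine Finset.sum_congr rfl fun τ hτ => ?_
  dsimp only
  rw [map_smul, map_smul]
  congr 1
  refine hbasis τ ?_
  have : B.degP τ = α := by
    by_contra h
    exact (Finsupp.mem_support_iff.1 hτ) (B.coord_eq_zero ht h)
  rwa [this]

end IsModelMap

end model

end

theorem mainTheorem6 {d : ℕ} {Tp T : Type*} [Ring Tp] [HopfAlgebra ℝ Tp]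
    [AddCommGroup T] [Module ℝ T] (S : ConcreteRegularityStructure Tp T)
    {ιp ι : Type*} (B : HomogeneousBases S ιp ι) (P : DyadicPartition d)
    (g : EuclideanSpace ℝ (Fin d) → Tp →ₐ[ℝ] ℝ) (hg : IsModelMap B g) :
    (∀ ν τ : ιp, ν ∈ B.betweenP B.one τ →
      P.ParaConverges (funDistribution (fun x => g x (B.quotP τ ν))) (bracketBasis B P g ν)) ∧
    ∀ σ τ : ι, B.lt σ τ →
      (∀ η ∈ B.between σ τ,
        P.ParaConverges (funDistribution (fun x => g x (B.quot τ η)))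
          (bracket B P g (B.quot η σ))) ∧
      funDistribution (fun x => g x (B.quot τ σ)) =
        (∑ η ∈ B.between σ τ,
          P.para (funDistribution (fun x => g x (B.quot τ η))) (bracket B P g (B.quot η σ))) +
        bracket B P g (B.quot τ σ) := by
  refine ⟨fun ν τ _ => ?_, fun σ τ h => ⟨fun η _ => ?_, ?_⟩⟩
  · obtain ⟨C, hC⟩ := hg.isBoundedFunction (B.quotP τ ν)
    exact P.paraConverges hC (hg.bracketBasis_mem_boundedBlocks P ν)
  · obtain ⟨C, hC⟩ := hg.isBoundedFunction (B.quot τ η)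
    exact P.paraConverges hC (hg.bracket_mem_boundedBlocks P _)
  · have h1 := hg.toDistribution_eq P (sub_pos.2 (B.deg_lt h)) (B.quot_mem_gradeP h.2)
    rw [B.reduced_comul_quot h, map_sum] at h1
    exact h1
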